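/- Let $d\ge 2$ and let $\sigma,\gamma,\mu>0$ and $E_{\max}\in\mathbb R$. There is a constant $C>0$, depending only on $d,\sigma,\gamma,\mu,E_{\max}$, such that the following holds. **Mesh.** Let $\mathcal T_h$ be a conforming simplicial triangulation, without geometric error, of a bounded polyhedral domain $\Omega\subset\mathbb R^d$, with nodes $x_i$, hat functions $\varphi_i$ and mesh size $h=\max_T \operatorname{diam}T$. Assume that it is shape regular (every element $T$ contains a ball of radius $\operatorname{diam}(T)/\sigma$), quasi-uniform ($h\le\gamma\operatorname{diam}T$ for every $T$) and weakly acute: $k_{ij}:=-\int_\Omega\nabla\varphi_i\cdot\nabla\varphi_j\,dx\ge 0$ for $i\ne j$. All discrete functions are continuous and piecewise linear on $\mathcal T_h$, $I_h$ is the Lagrange interpolation, $s_i=s_h(x_i)$, etc., and $\delta_{ij}w=w_i-w_j$. Line fields $\Theta_h$ are matrix valued with $\Theta_i\in\{\mathbf n\otimes\mathbf n:|\mathbf n|=1\}$. **Energy.** Let $\eta_B>0$ and let $\psi=\psi_c-\psi_e\ge 0$ on an interval $J\subset\mathbb R$, with $\psi_c,\psi_e$ convex and $C^1$ on $J$ (for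 a double well that blows up at $-\frac1{d-1}$ and $1$, $J=(-\frac1{d-1},1)$). Put $$\mathring E^h[s_h,\Theta_h]=\tfrac12\sum_{i,j}k_{ij}\tfrac{s_i^2+s_j^2}{2}|\delta_{ij}\Theta|^2,$$ $$E^h_{\rm uni}[s_h,\Theta_h]=\tfrac{d-1}{4d}\sum_{i,j}k_{ij}(\delta_{ij}s)^2+\tfrac12\mathring E^h[s_h,\Theta_h]+\tfrac1{\eta_B}\int_\Omega\psi(s_h)\,dx,$$ $$\delta_\Theta\mathring E^h[s_h,\Theta_h;V_h]=\sum_{i,j}k_{ij}\tfrac{s_i^2+s_j^2}{2}\,\delta_{ij}\Theta:\delta_{ij}V,\qquad \delta_s\mathring E^h[s_h,\Theta_h;z_h]=\sum_{i,j}k_{ij}|\delta_{ij}\Theta|^2\,\tfrac{s_iz_i+s_jz_j}{2}.$$ For a weight $\omega\ge0$ let $(t,v)_{H^1_\omega}=\int_\Omega t\cdot v\,dx+\int_\Omega\omega\,\nabla t:\nabla v\,dx$. **Scheme.** Let $g$, $M$ be Dirichlet data for $s$ and $\Theta$ on $\Gamma_s,\Gamma_\Theta\subset\partial\Omega$. Let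 $(s_h^0,\Theta_h^0)$ be discretely admissible: $s^0_h=I_hg$ on $\Gamma_s$; $\Theta_h^0=I_hM$ and $I_h(s_h^0\Theta_h^0)=I_h(gM)$ on $\Gamma_\Theta$; $-\frac1{d-1}\le s_h^0\le1$; $\Theta_i^0=\mathbf n_i^0\otimes\mathbf n_i^0$ with $|\mathbf n_i^0|=1$. Assume also $s_i^0\in J$ and $E^h_{\rm uni}[s_h^0,\Theta_h^0]\le E_{\max}$. For $0\le k<N$ let $\mathbf t_h^k,\Theta_h^{k+1},s_h^{k+1}$ satisfy, with time step $\delta t>0$: 1. (Weighted tangent flow.) $\mathbf t^k_i\cdot\mathbf n^k_i=0$ at all nodes, $\mathbf t_h^k=0$ on $\Gamma_\Theta$, and for all $\mathbf v_h$ with the same two properties, with $T_i=\mathbf n^k_i\otimes \mathbf t^k_i+\mathbf t^k_i\otimes\mathbf n^k_i$ and $V_i=\mathbf n^k_i\otimes \mathbf v_i+\mathbf v_i\otimes\mathbf n^k_i$, $$\tfrac1{\delta t}(\mathbf t_h^k,\mathbf v_h)_{H^1_{(s_h^k)^2}}=-\mu\,\delta_\Theta\mathring E^h[s_h^k,\Theta_h^k+T_h;V_h].$$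 2. (Projection.) $\Theta_i^{k+1}=\mathbf n_i^{k+1}\otimes\mathbf n_i^{k+1}=\frac{\mathbf n_i^k+\mathbf t_i^k}{|\mathbf n_i^k+\mathbf t_i^k|}\otimes\frac{\mathbf n_i^k+\mathbf t_i^k}{|\mathbf n_i^k+\mathbf t_i^k|}$ with $|\mathbf n_i^{k+1}|=1$. 3. (Gradient step for $s$, with convex splitting.) $s_h^{k+1}=I_hg$ on $\Gamma_s$, $s_i^{k+1}\in J$, and for all $z_h$ vanishing on $\Gamma_s$, $$\tfrac1{\delta t}(s_h^{k+1}-s_h^k,z_h)=-\tfrac{d-1}{d}(\nabla s_h^{k+1},\nabla z_h)-\tfrac12\delta_s\mathring E^h[s_h^{k+1},\Theta_h^{k+1};z_h]-\tfrac1{\eta_B}(\psi_c'(s_h^{k+1})-\psi_e'(s_h^k),z_h).$$ **Claim.** If $\delta t<C\,h^{d/2}$, then $$E_{\rm uni}^h[s_h^N,\Theta_h^N]+\frac1{\delta t}\sum_{k=0}^{N-1}\Big(\frac1{2\mu}\|\mathbf t_h^k\|^2_{H^1_{(s_h^k)^2}(\Omega)}+\|s_h^{k+1}-s_h^k\|^2_{L^2(\Omega)}\Big)\le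 E_{\rm uni}^h[s_h^0,\Theta_h^0],$$ and $E_{\rm uni}^h[s_h^{k+1},\Theta_h^{k+1}]\le E_{\rm uni}^h[s_h^k,\Theta_h^k]$ for all $k<N$. For $\mu=\frac12$, Step 1 is the flow of the full energy, with right-hand side $-\delta_\Theta E^h_{\rm uni}$, and the coefficient of $\|\mathbf t_h^k\|^2$ is $1$; for $\mu=1$ the right-hand side is $-\delta_\Theta\mathring E^h$ and the coefficient is $\frac12$. -/

import Mathlib

open MeasureTheory

noncomputable section

namespace UniaxialQ

/-- Euclidean space `ℝ^d`. -/
abbrev Space (d : ℕ) : Type := EuclideanSpace ℝ (Fin d)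

/-- A conforming simplicial triangulation of a bounded polyhedral domain `Ω` of `ℝ^d`: a finite
geometric simplicial complex all of whose faces are contained in `d`-dimensional simplices.
The closure of `Ω` is the underlying space of the complex. -/
structure Mesh (d : ℕ) extends Geometry.SimplicialComplex ℝ (Space d) where
  finite_faces : faces.Finite
  pure : ∀ F ∈ faces, ∃ T ∈ faces, F ⊆ T ∧ T.card = d + 1

namespace Mesh

variable {d : ℕ} (𝒯 : Mesh d)

/-- The closed polyhedral domain. Integrals over `Ω` are taken over this set
(the boundary of `Ω` is a null set). -/
def domain : Set (Space d) := 𝒯.toSimplicialComplex.space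

/-- The elements of the mesh, given by their vertex sets. -/
def cells : Set (Finset (Space d)) := {T | T ∈ 𝒯.faces ∧ T.card = d + 1}

/-- The nodes (vertices) of the mesh. -/
def Node : Type := {x : Space d // {x} ∈ 𝒯.faces}

/-- The position of a node. -/
def pos (i : 𝒯.Node) : Space d := i.1

instance : Finite 𝒯.Node :=
  ((𝒯.finite_faces.preimage Finset.singleton_injective.injOn).to_subtype :
    Finite {x : Space d // {x} ∈ 𝒯.faces})

instance : Fintype 𝒯.Node := Fintype.ofFinite _

/-- The diameter of an element. -/
def cellDiam (T : Finset (Space d)) : ℝ := Metric.diam (convexHull ℝ (T : Set (Space d)))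

/-- The mesh size `h`: the largest diameter of an element. -/
def meshSize : ℝ := sSup (cellDiam '' 𝒯.cells)

/-- Shape regularity with constant `σ`: every element `T` contains a ball of radius
`diam T / σ`. -/
def ShapeRegular (σ : ℝ) : Prop :=
  ∀ T ∈ 𝒯.cells, ∃ c : Space d,
    Metric.closedBall c (cellDiam T / σ) ⊆ convexHull ℝ (T : Set (Space d))

/-- Quasi-uniformity with constant `γ`: all elements have diameter at least `h / γ`. -/
def QuasiUniform (γ : ℝ) : Prop := ∀ T ∈ 𝒯.cells, 𝒯.meshSize ≤ γ * cellDiam T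

/-- `w` is a system of barycentric coordinates of `x`: nonnegative weights, supported on the
vertices of a face of the mesh, of total mass one and with barycentre `x`. -/
def IsBary (x : Space d) (w : Space d → ℝ) : Prop :=
  ∃ T ∈ 𝒯.faces, (∀ y ∈ T, 0 ≤ w y) ∧ (∀ y ∉ T, w y = 0) ∧
    ∑ y ∈ T, w y = 1 ∧ ∑ y ∈ T, w y • y = x

open Classical in
/-- The barycentric coordinates of a point of the domain (zero outside of the domain). -/
def bary (x : Space d) : Space d → ℝ :=
  if h : ∃ w, 𝒯.IsBary x w then h.choose else 0

/-- The piecewise linear hat function `φ_i` of the node `x_i`. -/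
def hat (i : 𝒯.Node) (x : Space d) : ℝ := 𝒯.bary x (𝒯.pos i)

/-- The continuous piecewise linear finite element function with nodal values `c`, that is
`∑ i, c_i φ_i`. Finite element functions are represented by their nodal values throughout. -/
def fe {V : Type*} [AddCommMonoid V] [Module ℝ V] (c : 𝒯.Node → V) (x : Space d) : V :=
  ∑ i, 𝒯.hat i x • c i

/-- Nodal values of the Lagrange interpolant `I_h f`. -/
def nodal {V : Type*} (f : Space d → V) : 𝒯.Node → V := fun i => f (𝒯.pos i)

end Mesh

section Calculus

variable {d : ℕ} {V : Type*} [NormedAddCommGroup V] [InnerProductSpace ℝ V]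

/-- The pointwise inner product `∇f(x) : ∇g(x)` of two gradients. -/
def gradInner (f g : Space d → V) (x : Space d) : ℝ :=
  ∑ a : Fin d, inner ℝ (fderiv ℝ f x (EuclideanSpace.single a 1))
    (fderiv ℝ g x (EuclideanSpace.single a 1))

/-- The `L²(Ω)` inner product. -/
def l2Inner (Ω : Set (Space d)) (f g : Space d → V) : ℝ := ∫ x in Ω, inner ℝ (f x) (g x)

/-- The inner product `(∇f, ∇g)` in `L²(Ω)`. -/
def dirichletInner (Ω : Set (Space d)) (f g : Space d → V) : ℝ := ∫ x in Ω, gradInner f g x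

/-- The inner product of the weighted space `H¹_ω(Ω)`; the square of the `H¹_ω(Ω)` norm of `f`
is `weightedInner Ω ω f f`. -/
def weightedInner (Ω : Set (Space d)) (ω : Space d → ℝ) (f g : Space d → V) : ℝ :=
  (∫ x in Ω, inner ℝ (f x) (g x)) + ∫ x in Ω, gradInner f g x * ω x

end Calculus

section Tensors

variable {d : ℕ}

/-- The tensor product `n ⊗ v`. -/
def outer (n v : Space d) : Matrix (Fin d) (Fin d) ℝ := Matrix.of fun a b => n a * v b

/-- The Frobenius product `A : B`. -/
def frob (A B : Matrix (Fin d) (Fin d) ℝ) : ℝ := ∑ a, ∑ b, A a b * B a b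

/-- The line fields `𝕃^{d-1} = {n ⊗ n : |n| = 1}`. -/
def LineField (d : ℕ) : Set (Matrix (Fin d) (Fin d) ℝ) := {A | ∃ n : Space d, ‖n‖ = 1 ∧ A = outer n n}

end Tensors

namespace Mesh

variable {d : ℕ} (𝒯 : Mesh d)

/-- `k_ij = -∫_Ω ∇φ_i · ∇φ_j`. -/
def stiff (i j : 𝒯.Node) : ℝ := -dirichletInner 𝒯.domain (𝒯.hat i) (𝒯.hat j)

/-- The mesh is weakly acute: `k_ij ≥ 0` for all `i ≠ j`. -/
def WeaklyAcute : Prop := ∀ i j, i ≠ j → 0 ≤ 𝒯.stiff i j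

end Mesh

/-- A nonnegative bulk potential `ψ = ψ_c - ψ_e` on a convex set `dom` of real numbers, with a
splitting into continuously differentiable convex functions `ψ_c` and `ψ_e`. The functions `dψ_c`
and `dψ_e` are the derivatives. A double well that blows up at the ends of its range has the open
range as `dom`. -/
structure SplitPotential where
  dom : Set ℝ
  ψc : ℝ → ℝ
  ψe : ℝ → ℝ
  dψc : ℝ → ℝ
  dψe : ℝ → ℝ
  convex_c : ConvexOn ℝ dom ψc
  convex_e : ConvexOn ℝ dom ψe
  deriv_c : ∀ r ∈ dom, HasDerivWithinAt ψc (dψc r) dom r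
  deriv_e : ∀ r ∈ dom, HasDerivWithinAt ψe (dψe r) dom r
  cont_c : ContinuousOn dψc dom
  cont_e : ContinuousOn dψe dom
  nonneg : ∀ r ∈ dom, 0 ≤ ψc r - ψe r

section Energy

variable {d : ℕ} (𝒯 : Mesh d)

/-- The discrete energy
`E̊_uni^h[s,Θ] = 1/2 ∑_ij k_ij (s_i² + s_j²)/2 |Θ_i - Θ_j|²`. -/
def ringEnergy (s : 𝒯.Node → ℝ) (Θ : 𝒯.Node → Matrix (Fin d) (Fin d) ℝ) : ℝ :=
  1 / 2 * ∑ i, ∑ j, 𝒯.stiff i j * ((s i ^ 2 + s j ^ 2) / 2) * frob (Θ i - Θ j) (Θ i - Θ j)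

/-- The main part of the discrete energy. -/
def mainEnergy (s : 𝒯.Node → ℝ) (Θ : 𝒯.Node → Matrix (Fin d) (Fin d) ℝ) : ℝ :=
  ((d : ℝ) - 1) / (4 * d) * (∑ i, ∑ j, 𝒯.stiff i j * (s i - s j) ^ 2) +
    1 / 4 * ∑ i, ∑ j, 𝒯.stiff i j * ((s i ^ 2 + s j ^ 2) / 2) * frob (Θ i - Θ j) (Θ i - Θ j)

/-- The bulk energy `(1/η_B) ∫_Ω ψ(s_h)`. -/
def bulkEnergy (ψ : SplitPotential) (ηB : ℝ) (s : 𝒯.Node → ℝ) : ℝ :=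
  1 / ηB * ∫ x in 𝒯.domain, (ψ.ψc (𝒯.fe s x) - ψ.ψe (𝒯.fe s x))

/-- The discrete uniaxial Landau-deGennes energy `E_uni^h[s,Θ]`. -/
def energy (ψ : SplitPotential) (ηB : ℝ) (s : 𝒯.Node → ℝ)
    (Θ : 𝒯.Node → Matrix (Fin d) (Fin d) ℝ) : ℝ :=
  mainEnergy 𝒯 s Θ + bulkEnergy 𝒯 ψ ηB s

/-- The variational derivative `δ_Θ E̊_uni^h[s, Θ; V]`. -/
def ringVarTheta (s : 𝒯.Node → ℝ) (Θ V : 𝒯.Node → Matrix (Fin d) (Fin d) ℝ) : ℝ :=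
  ∑ i, ∑ j, 𝒯.stiff i j * ((s i ^ 2 + s j ^ 2) / 2) * frob (Θ i - Θ j) (V i - V j)

/-- The variational derivative `δ_s E̊_uni^h[s, Θ; z]`. -/
def ringVarS (s : 𝒯.Node → ℝ) (Θ : 𝒯.Node → Matrix (Fin d) (Fin d) ℝ) (z : 𝒯.Node → ℝ) : ℝ :=
  ∑ i, ∑ j, 𝒯.stiff i j * frob (Θ i - Θ j) (Θ i - Θ j) * ((s i * z i + s j * z j) / 2)

/-- The line field `Θ_i = n_i ⊗ n_i` of a nodal director field. -/
def lineOf (n : 𝒯.Node → Space d) : 𝒯.Node → Matrix (Fin d) (Fin d) ℝ := fun i => outer (n i) (n i)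

/-- The tangential variation `n_i ⊗ v_i + v_i ⊗ n_i`. -/
def tangentTensor (n v : 𝒯.Node → Space d) : 𝒯.Node → Matrix (Fin d) (Fin d) ℝ :=
  fun i => outer (n i) (v i) + outer (v i) (n i)

/-- The discrete admissible class `A_uni^h(g_h, M_h)`, with `U_h = I_h(s_h Θ_h)` and
`R = g M`. -/
structure Admissible (Γs ΓΘ : Set (Space d)) (g : Space d → ℝ)
    (M : Space d → Matrix (Fin d) (Fin d) ℝ) (s : 𝒯.Node → ℝ)
    (Θ : 𝒯.Node → Matrix (Fin d) (Fin d) ℝ) : Prop where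
  s_bdry : ∀ x ∈ Γs, 𝒯.fe s x = 𝒯.fe (𝒯.nodal g) x
  Θ_bdry : ∀ x ∈ ΓΘ, 𝒯.fe Θ x = 𝒯.fe (𝒯.nodal M) x
  U_bdry : ∀ x ∈ ΓΘ, 𝒯.fe (fun i => s i • Θ i) x = 𝒯.fe (𝒯.nodal fun y => g y • M y) x
  range : ∀ x ∈ 𝒯.domain, -(1 / ((d : ℝ) - 1)) ≤ 𝒯.fe s x ∧ 𝒯.fe s x ≤ 1
  line : ∀ i, Θ i ∈ LineField d

/-- The functions `v_h ∈ V_h^⊥(n_h) ∩ H¹_{Γ_Θ}(Ω)`: nodal values orthogonal to `n_h`, and zero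
boundary values on `Γ_Θ`. -/
def Tangential (ΓΘ : Set (Space d)) (n v : 𝒯.Node → Space d) : Prop :=
  (∀ i, inner ℝ (v i) (n i) = 0) ∧ ∀ x ∈ ΓΘ, 𝒯.fe v x = 0

/-- One step `(s, n ⊗ n) ↦ (s', n' ⊗ n')`, with tangential update `t`, of the quasi-gradient
flow with time step `δt`. The factor `μ` normalizes the tangent flow: it follows the negative
gradient of `μ E̊_uni^h`, so that `μ = 1/2` is the flow of `E_uni^h` and `μ = 1` that of
`E̊_uni^h`. -/
structure IsFlowStep (ψ : SplitPotential) (ηB μ δt : ℝ) (Γs ΓΘ : Set (Space d)) (g : Space d → ℝ)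
    (s s' : 𝒯.Node → ℝ) (n n' t : 𝒯.Node → Space d) : Prop where
  /-- Step 1, weighted tangent flow. -/
  t_mem : Tangential 𝒯 ΓΘ n t
  tangent_flow : ∀ v, Tangential 𝒯 ΓΘ n v →
    1 / δt * weightedInner 𝒯.domain (fun x => 𝒯.fe s x ^ 2) (𝒯.fe t) (𝒯.fe v) =
      -(μ * ringVarTheta 𝒯 s (lineOf 𝒯 n + tangentTensor 𝒯 n t) (tangentTensor 𝒯 n v))
  /-- Step 2, nodal projection. Only the line field of `n'` is prescribed, not its sign. -/
  unit' : ∀ i, ‖n' i‖ = 1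
  projection : ∀ i, outer (n' i) (n' i) =
    outer (‖n i + t i‖⁻¹ • (n i + t i)) (‖n i + t i‖⁻¹ • (n i + t i))
  /-- Step 3, implicit gradient step for `s` with convex splitting of the potential. -/
  s_bdry : ∀ x ∈ Γs, 𝒯.fe s' x = 𝒯.fe (𝒯.nodal g) x
  s_dom : ∀ i, s' i ∈ ψ.dom
  s_flow : ∀ z : 𝒯.Node → ℝ, (∀ x ∈ Γs, 𝒯.fe z x = 0) →
    1 / δt * l2Inner 𝒯.domain (𝒯.fe (s' - s)) (𝒯.fe z) =
      -(((d : ℝ) - 1) / d * dirichletInner 𝒯.domain (𝒯.fe s') (𝒯.fe z))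
        - 1 / 2 * ringVarS 𝒯 s' (lineOf 𝒯 n') z
        - 1 / ηB * ∫ x in 𝒯.domain, (ψ.dψc (𝒯.fe s' x) - ψ.dψe (𝒯.fe s x)) * 𝒯.fe z x

end Energy

end UniaxialQ

end

noncomputable section
namespace UniaxialQ
namespace Mesh

variable {d : ℕ} (𝒯 : Mesh d)

/-! Each time step splits into the director update and the update of `s`, and each half decreases
the energy. Weak acuteness makes the off-diagonal weights `k_ij` nonnegative, so inequalities for
pairs of nodal values can be summed.

Tangent flow and projection (`mainEnergy_projection_le`). Normalizing `n + t` does not increase line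
field distances because `|n + t| ≥ 1` (`frob_sub_normalize_le`). Before normalization, `(n + t) ⊗ (n
+ t) = Θ + T + Q` with `Q = t ⊗ t`. Expanding the squared distance gives the decrease dictated by
the flow, a spare term `-1/2 |δT|²`, and an error quadratic in `δQ` (`frob_sub_projection_le`).
Write `W` for the squared weighted norm of `t` and `A2` for the sum of the weighted `|δT|²`. An
inverse estimate bounds `max |t_i|²` by a multiple of `h^(-d) W` (`norm_sq_le_integral`), and the
weighted discrete Dirichlet sum of `t` is at most a multiple of `W`
(`sum_stiff_mul_norm_sub_sq_le`), so the error is at most a multiple of `h^(-d) W²`. Testing the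
flow with `t` and applying Cauchy-Schwarz gives `W² ≤ 4 (μ δt)² |Emax| A2`. Hence the spare term
absorbs the error once `δt²` is at most a small multiple of `h^d`.

Gradient step (`energy_gradientStep_le`). The quadratic terms are convex in `s` and taken
implicitly. Convex splitting handles the potential, so this half needs no restriction on `δt`.

The step restriction depends on the current energy only through `Emax`. Energy decrease preserves
that bound, so the estimate can be iterated and the dissipation telescopes. -/

/-! ### Barycentric coordinates and hat functions. -/

theorem eq_weights_of_affineIndependent {E : Type*} [AddCommGroup E] [Module ℝ E] {F : Finset E}
    (hF : AffineIndependent ℝ ((↑) : F → E)) {w w' : E → ℝ}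
    (h1 : ∑ y ∈ F, w y = ∑ y ∈ F, w' y) (h2 : ∑ y ∈ F, w y • y = ∑ y ∈ F, w' y • y) :
    ∀ y ∈ F, w y = w' y := by
  intro y hy
  have key := affineIndependent_iff.1 hF Finset.univ (fun z : F => w z - w' z) ?_ ?_ ⟨y, hy⟩
    (Finset.mem_univ _)
  · simpa [sub_eq_zero] using key
  · rw [Finset.sum_sub_distrib, Finset.sum_coe_sort F w, Finset.sum_coe_sort F w', h1, sub_self]
  · simp_rw [sub_smul]
    rw [Finset.sum_sub_distrib, Finset.sum_coe_sort F (fun z => w z • z),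
      Finset.sum_coe_sort F (fun z => w' z • z), h2, sub_self]

/-- Two faces containing `x` meet in the hull of their common vertices. Weights of `x` on those
vertices, extended by zero, must agree with both given systems by affine independence. This makes
the choice in `bary` harmless. -/
theorem IsBary.unique {𝒯 : Mesh d} {x : Space d} {w w' : Space d → ℝ} (hw : 𝒯.IsBary x w)
    (hw' : 𝒯.IsBary x w') : w = w' := by
  classical
  obtain ⟨F, hF, h0, hz, h1, hx⟩ := hw
  obtain ⟨G, hG, h0', hz', h1', hx'⟩ := hw'
  have hxF : x ∈ convexHull ℝ (F : Set (Space d)) :=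
    Finset.mem_convexHull'.2 ⟨w, h0, h1, hx⟩
  have hxG : x ∈ convexHull ℝ (G : Set (Space d)) :=
    Finset.mem_convexHull'.2 ⟨w', h0', h1', hx'⟩
  have hxFG := 𝒯.inter_subset_convexHull hF hG ⟨hxF, hxG⟩
  rw [← Finset.coe_inter, Finset.mem_convexHull'] at hxFG
  obtain ⟨v, -, hv1, hvx⟩ := hxFG
  have ext : ∀ H : Finset (Space d), F ∩ G ⊆ H →
      (∑ y ∈ H, (if y ∈ F ∩ G then v y else 0)) = 1 ∧
      (∑ y ∈ H, (if y ∈ F ∩ G then v y else 0) • y) = x := by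
    intro H hH
    constructor
    · rw [← hv1, ← Finset.sum_subset hH (fun y _ hy => if_neg hy)]
      exact Finset.sum_congr rfl fun y hy => if_pos hy
    · rw [← hvx, ← Finset.sum_subset hH (fun y _ hy => by rw [if_neg hy, zero_smul])]
      exact Finset.sum_congr rfl fun y hy => by rw [if_pos hy]
  have eF := eq_weights_of_affineIndependent (𝒯.indep hF) (h1.trans (ext F Finset.inter_subset_left).1.symm)
    (hx.trans (ext F Finset.inter_subset_left).2.symm)
  have eG := eq_weights_of_affineIndependent (𝒯.indep hG) (h1'.trans (ext G Finset.inter_subset_right).1.symm)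
    (hx'.trans (ext G Finset.inter_subset_right).2.symm)
  funext y
  by_cases hyF : y ∈ F <;> by_cases hyG : y ∈ G
  · rw [eF y hyF, eG y hyG]
  · rw [eF y hyF, hz' y hyG, if_neg (by simp [hyG])]
  · rw [eG y hyG, hz y hyF, if_neg (by simp [hyF])]
  · rw [hz y hyF, hz' y hyG]

theorem bary_eq {x : Space d} {w : Space d → ℝ} (hw : 𝒯.IsBary x w) : 𝒯.bary x = w := by
  have h : ∃ w, 𝒯.IsBary x w := ⟨w, hw⟩
  rw [bary, dif_pos h]
  exact h.choose_spec.unique hw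

theorem exists_affineBasis_cell {T : Finset (Space d)} (hT : T ∈ 𝒯.cells) :
    ∃ b : AffineBasis T ℝ (Space d), ⇑b = ((↑) : T → Space d) := by
  refine ⟨⟨_, 𝒯.indep hT.1, ?_⟩, rfl⟩
  rw [(𝒯.indep hT.1).affineSpan_eq_top_iff_card_eq_finrank_add_one]
  simpa using hT.2

theorem exists_node {T : Finset (Space d)} (hT : T ∈ 𝒯.cells) {y : Space d} (hy : y ∈ T) :
    ∃ i, 𝒯.pos i = y :=
  ⟨⟨y, 𝒯.down_closed hT.1 (by simpa using hy) (Finset.singleton_nonempty y)⟩, rfl⟩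

theorem pos_injective : Function.Injective 𝒯.pos := fun _ _ h => Subtype.ext h

theorem isBary_coord {T : Finset (Space d)} (hT : T ∈ 𝒯.cells) (b : AffineBasis T ℝ (Space d))
    (hb : ⇑b = ((↑) : T → Space d)) {x : Space d} (hx : x ∈ convexHull ℝ (T : Set (Space d)))
    {w : Space d → ℝ} (hw : ∀ y : T, w y = b.coord y x) (hw0 : ∀ y ∉ T, w y = 0) :
    𝒯.IsBary x w := by
  refine ⟨T, hT.1, ?_, hw0, ?_, ?_⟩
  · intro y hy
    rw [hw ⟨y, hy⟩]
    have h := b.convexHull_eq_nonneg_coord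
    rw [hb, Subtype.range_coe_subtype] at h
    have hx' : x ∈ convexHull ℝ {x | x ∈ T} := hx
    rw [h] at hx'
    exact hx' ⟨y, hy⟩
  · rw [← Finset.sum_coe_sort T w, Finset.sum_congr rfl fun y _ => hw y]
    exact b.sum_coord_apply_eq_one x
  · rw [← Finset.sum_coe_sort T (fun y => w y • y), Finset.sum_congr rfl fun y _ => by rw [hw y]]
    have := b.linear_combination_coord_eq_self x
    simpa [hb] using this

open Classical in
/-- On each cell, the hat functions are affine. -/
theorem exists_affine_hat {T : Finset (Space d)} (hT : T ∈ 𝒯.cells) :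
    ∃ (a : 𝒯.Node → ℝ) (ℓ : 𝒯.Node → Space d →L[ℝ] ℝ),
      (∀ x ∈ convexHull ℝ (T : Set (Space d)), ∀ i, 𝒯.hat i x = a i + ℓ i x) ∧
      (∀ i, 𝒯.pos i ∉ T → ℓ i = 0) ∧ ∑ i, ℓ i = 0 ∧
      (∀ x ∈ convexHull ℝ (T : Set (Space d)), (∀ i, 0 ≤ 𝒯.hat i x) ∧ ∑ i, 𝒯.hat i x = 1) ∧
      (∀ i j, 𝒯.pos j ∈ T → 𝒯.hat i (𝒯.pos j) = if i = j then 1 else 0) := by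
  obtain ⟨b, hb⟩ := 𝒯.exists_affineBasis_cell hT
  let c : 𝒯.Node → (Space d →ᵃ[ℝ] ℝ) := fun i =>
    if h : 𝒯.pos i ∈ T then b.coord ⟨𝒯.pos i, h⟩ else 0
  let w : Space d → Space d → ℝ := fun x y => if h : y ∈ T then b.coord ⟨y, h⟩ x else 0
  have hbary : ∀ x ∈ convexHull ℝ (T : Set (Space d)), 𝒯.bary x = w x ∧ 𝒯.IsBary x (w x) := by
    intro x hx
    have := 𝒯.isBary_coord hT b hb hx (w := w x) (fun y => by simp [w]) (fun y hy => by simp [w, hy])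
    exact ⟨𝒯.bary_eq this, this⟩
  have hhat : ∀ x ∈ convexHull ℝ (T : Set (Space d)), ∀ i, 𝒯.hat i x = c i x := by
    intro x hx i
    simp only [hat, (hbary x hx).1, w, c]
    split_ifs <;> rfl
  -- The coordinates sum to one at every point of the space, not only on the cell. This is what
  -- forces the gradients to sum to zero.
  have hsum : ∀ x, ∑ i, c i x = 1 := by
    intro x
    rw [← b.sum_coord_apply_eq_one x]
    symm
    choose f hf using fun y : T => 𝒯.exists_node hT y.2
    refine Finset.sum_of_injOn f ?_ ?_ ?_ ?_
    · intro y _ z _ hyz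
      exact Subtype.ext ((hf y).symm.trans ((congrArg 𝒯.pos hyz).trans (hf z)))
    · simp
    · intro i _ hi
      by_cases h : 𝒯.pos i ∈ T
      · exact absurd ⟨⟨𝒯.pos i, h⟩, by simp, 𝒯.pos_injective (hf _)⟩ hi
      · simp [c, h]
    · intro y _
      have : 𝒯.pos (f y) ∈ T := by rw [hf]; exact y.2
      simp [c, hf]
  refine ⟨fun i => c i 0, fun i => LinearMap.toContinuousLinearMap (c i).linear, ?_, ?_, ?_, ?_, ?_⟩
  · intro x hx i
    rw [hhat x hx i]
    have := congrFun (c i).decomp x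
    simp only [Pi.add_apply] at this
    rw [this]
    simp [add_comm]
  · intro i hi
    ext x
    simp [c, hi]
  · ext x
    have h := hsum x
    rw [← hsum 0, ← sub_eq_zero, ← Finset.sum_sub_distrib] at h
    rw [sum_apply, zero_apply, ← h]
    refine Finset.sum_congr rfl fun i _ => ?_
    have := (c i).linearMap_vsub x 0
    simpa using this
  · intro x hx
    refine ⟨fun i => ?_, ?_⟩
    · rw [hat, (hbary x hx).1]
      obtain ⟨F, -, h0, hz, -⟩ := (hbary x hx).2
      by_cases h : 𝒯.pos i ∈ F
      · exact h0 _ h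
      · exact (hz _ h).ge
    · rw [← hsum x]
      exact Finset.sum_congr rfl fun i _ => hhat x hx i
  · intro i j hj
    rw [hhat _ (subset_convexHull ℝ _ hj)]
    by_cases h : 𝒯.pos i ∈ T
    · simp only [c, dif_pos h]
      have hbj : b ⟨𝒯.pos j, hj⟩ = 𝒯.pos j := by rw [hb]
      rw [← hbj, b.coord_apply]
      simp [𝒯.pos_injective.eq_iff]
    · have : i ≠ j := fun e => h (e ▸ hj)
      simp [c, h, this]

/-! ### Decomposition of the domain into cells. -/

theorem finite_cells : 𝒯.cells.Finite := 𝒯.finite_faces.subset fun _ h => h.1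

/-- The finite set of elements. -/
def cellSet : Finset (Finset (Space d)) := 𝒯.finite_cells.toFinset

theorem mem_cellSet {T : Finset (Space d)} : T ∈ 𝒯.cellSet ↔ T ∈ 𝒯.cells := by
  simp [cellSet]

theorem domain_eq : 𝒯.domain = ⋃ T ∈ 𝒯.cellSet, convexHull ℝ (T : Set (Space d)) := by
  ext x
  simp only [domain, Geometry.SimplicialComplex.mem_space_iff, Set.mem_iUnion, mem_cellSet]
  constructor
  · rintro ⟨F, hF, hx⟩
    obtain ⟨T, hT, hFT, hc⟩ := 𝒯.pure F hF
    exact ⟨T, ⟨hT, hc⟩, convexHull_mono (by exact_mod_cast hFT) hx⟩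
  · rintro ⟨T, hT, hx⟩
    exact ⟨T, hT.1, hx⟩

/-- Both cells have `d + 1` vertices, so some vertex `y` of `T` is not in `T'`. Its barycentric
coordinate is positive in the interior of `T` but vanishes on the hull of the common vertices, where
any common point would lie. -/
theorem disjoint_interior {T T' : Finset (Space d)} (hT : T ∈ 𝒯.cells) (hT' : T' ∈ 𝒯.cells)
    (hne : T ≠ T') : Disjoint (interior (convexHull ℝ (T : Set (Space d))))
      (interior (convexHull ℝ (T' : Set (Space d)))) := by
  classical
  rw [Set.disjoint_left]
  intro x hx hx'
  have hmem := 𝒯.inter_subset_convexHull hT.1 hT'.1 ⟨interior_subset hx, interior_subset hx'⟩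
  obtain ⟨y, hyT, hyT'⟩ : ∃ y ∈ T, y ∉ T' := by
    by_contra! h
    exact hne (Finset.eq_of_subset_of_card_le h (by rw [hT.2, hT'.2]))
  obtain ⟨b, hb⟩ := 𝒯.exists_affineBasis_cell hT
  have h := b.interior_convexHull
  rw [hb, Subtype.range_coe_subtype] at h
  have hx1 : x ∈ interior (convexHull ℝ {x | x ∈ T}) := hx
  rw [h] at hx1
  have hpos : 0 < b.coord ⟨y, hyT⟩ x := hx1 ⟨y, hyT⟩
  have hsub : convexHull ℝ ((T : Set (Space d)) ∩ T') ⊆ {z | b.coord ⟨y, hyT⟩ z ≤ 0} := by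
    refine convexHull_min ?_ ?_
    · rintro z ⟨hz, hz'⟩
      have hbz : b ⟨z, hz⟩ = z := by rw [hb]
      have hyz : (⟨y, hyT⟩ : T) ≠ ⟨z, hz⟩ := by
        intro e
        rw [Subtype.mk.injEq] at e
        exact hyT' (e ▸ hz')
      have := b.coord_apply_ne hyz
      rw [hbz] at this
      exact this.le
    · exact (convex_Iic (𝕜 := ℝ) (0 : ℝ)).affine_preimage _
  exact absurd (hsub hmem) (not_le.2 hpos)

end Mesh

/-! ### Estimates for affine functions on convex sets. -/

section LinearEstimates

variable {d : ℕ} {V : Type*} [NormedAddCommGroup V] [InnerProductSpace ℝ V]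

/-- The Hilbert-Schmidt inner product of two linear maps. -/
def hsInner (L L' : Space d →L[ℝ] V) : ℝ :=
  ∑ a : Fin d, inner ℝ (L (EuclideanSpace.single a 1)) (L' (EuclideanSpace.single a 1))

theorem hsInner_self_nonneg (L : Space d →L[ℝ] V) : 0 ≤ hsInner L L :=
  Finset.sum_nonneg fun _ _ => real_inner_self_nonneg

theorem norm_apply_sq_le_hsInner (L : Space d →L[ℝ] V) (v : Space d) :
    ‖L v‖ ^ 2 ≤ hsInner L L * ‖v‖ ^ 2 := by
  have hv : v = ∑ a, v a • EuclideanSpace.single a (1 : ℝ) := by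
    ext b
    simp [Finset.sum_apply, Pi.single_apply]
  have h1 : ‖L v‖ ≤ ∑ a, ‖L (EuclideanSpace.single a 1)‖ * |v a| := by
    conv_lhs => rw [hv, map_sum]
    refine (norm_sum_le _ _).trans (Finset.sum_le_sum fun a _ => ?_)
    rw [map_smul, norm_smul, Real.norm_eq_abs, mul_comm]
  calc ‖L v‖ ^ 2 ≤ (∑ a, ‖L (EuclideanSpace.single a 1)‖ * |v a|) ^ 2 := by gcongr
    _ ≤ (∑ a, ‖L (EuclideanSpace.single a 1)‖ ^ 2) * ∑ a, |v a| ^ 2 :=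
      Finset.sum_mul_sq_le_sq_mul_sq _ _ _
    _ = _ := by
      simp [hsInner, EuclideanSpace.norm_sq_eq]

open Pointwise in
/-- The value of an affine function at a point of a convex set is controlled by its `L²` norm. -/
theorem measureReal_mul_norm_sq_le {K : Set (Space d)} (hc : Convex ℝ K) (hK : IsCompact K)
    {p : Space d} (hp : p ∈ K) (L : Space d →L[ℝ] V) (v : V) :
    volume.real K * ‖v + L p‖ ^ 2 ≤ (2 ^ (d + 3) + 2) * ∫ x in K, ‖v + L x‖ ^ 2 := by
  set f : Space d → V := fun x => v + L x with hf
  have hcont : Continuous fun x => ‖f x‖ ^ 2 := by fun_prop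
  have hint : ∀ S : Set (Space d), S ⊆ K → IntegrableOn (fun x => ‖f x‖ ^ 2) S :=
    fun S hS => (hcont.continuousOn.integrableOn_compact hK).mono_set hS
  have hcont2 : Continuous fun x => ‖f ((2⁻¹ : ℝ) • x + (2⁻¹ : ℝ) • p)‖ ^ 2 := by fun_prop
  -- With `m` the midpoint of `x` and `p`, affinity gives `f p = 2 f m - f x`. The factors come from
  -- `(2a + b)² ≤ 8a² + 2b²`.
  have hpt : ∀ x, ‖f p‖ ^ 2 ≤ 8 * ‖f ((2⁻¹ : ℝ) • x + (2⁻¹ : ℝ) • p)‖ ^ 2 + 2 * ‖f x‖ ^ 2 := by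
    intro x
    have e : f p = (2 : ℝ) • f ((2⁻¹ : ℝ) • x + (2⁻¹ : ℝ) • p) - f x := by
      simp only [hf, map_add, map_smul, smul_add, smul_smul]
      norm_num
      module
    have h1 : ‖f p‖ ≤ 2 * ‖f ((2⁻¹ : ℝ) • x + (2⁻¹ : ℝ) • p)‖ + ‖f x‖ := by
      conv_lhs => rw [e]
      refine (norm_sub_le _ _).trans ?_
      rw [norm_smul]
      norm_num
    nlinarith [norm_nonneg (f p), norm_nonneg (f x),
      norm_nonneg (f ((2⁻¹ : ℝ) • x + (2⁻¹ : ℝ) • p)),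
      sq_nonneg (2 * ‖f ((2⁻¹ : ℝ) • x + (2⁻¹ : ℝ) • p)‖ - ‖f x‖)]
  -- The contraction `x ↦ (x + p)/2` maps `K` into itself by convexity and scales volume by
  -- `2^(-d)`. The resulting constant depends on the dimension only, not on the shape of `K`.
  have hshift : ∫ x in K, ‖f ((2⁻¹ : ℝ) • x + (2⁻¹ : ℝ) • p)‖ ^ 2 ≤
      2 ^ d * ∫ x in K, ‖f x‖ ^ 2 := by
    rw [Measure.setIntegral_comp_smul_of_pos volume
      (fun y => ‖f (y + (2⁻¹ : ℝ) • p)‖ ^ 2) K (by norm_num : (0 : ℝ) < 2⁻¹)]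
    simp only [finrank_euclideanSpace, Fintype.card_fin, smul_eq_mul, inv_pow, inv_inv]
    refine mul_le_mul_of_nonneg_left ?_ (by positivity)
    have hpre : (2⁻¹ : ℝ) • K = (fun y => y + (2⁻¹ : ℝ) • p) ⁻¹'
        ((fun y => y + (2⁻¹ : ℝ) • p) '' ((2⁻¹ : ℝ) • K)) :=
      (Set.preimage_image_eq _ (add_left_injective _)).symm
    rw [hpre, (measurePreserving_add_right volume ((2⁻¹ : ℝ) • p)).setIntegral_preimage_emb
      (MeasurableEquiv.addRight ((2⁻¹ : ℝ) • p)).measurableEmbedding (fun y => ‖f y‖ ^ 2)]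
    refine setIntegral_mono_set (hint K subset_rfl) (Filter.Eventually.of_forall fun _ => by
      positivity) (LE.le.eventuallyLE ?_)
    rintro _ ⟨_, ⟨x, hx, rfl⟩, rfl⟩
    exact hc hx hp (by norm_num) (by norm_num) (by norm_num)
  calc volume.real K * ‖f p‖ ^ 2 = ∫ _ in K, ‖f p‖ ^ 2 := by
        rw [setIntegral_const, smul_eq_mul]
    _ ≤ ∫ x in K, (8 * ‖f ((2⁻¹ : ℝ) • x + (2⁻¹ : ℝ) • p)‖ ^ 2 + 2 * ‖f x‖ ^ 2) := by
        refine integral_mono (continuousOn_const.integrableOn_compact hK)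
          (Continuous.continuousOn ?_ |>.integrableOn_compact hK) hpt
        fun_prop
    _ = 8 * (∫ x in K, ‖f ((2⁻¹ : ℝ) • x + (2⁻¹ : ℝ) • p)‖ ^ 2) + 2 * ∫ x in K, ‖f x‖ ^ 2 := by
        rw [integral_add ((hcont2.continuousOn.integrableOn_compact hK).const_mul 8)
          ((hint K subset_rfl).const_mul 2), integral_const_mul, integral_const_mul]
    _ ≤ 8 * (2 ^ d * ∫ x in K, ‖f x‖ ^ 2) + 2 * ∫ x in K, ‖f x‖ ^ 2 := by gcongr
    _ = _ := by ring

end LinearEstimates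

/-! ### Cellwise integration and the stiffness matrix. -/

namespace Mesh

variable {d : ℕ} (𝒯 : Mesh d) {V : Type*} [NormedAddCommGroup V] [InnerProductSpace ℝ V]

theorem isCompact_hull (T : Finset (Space d)) : IsCompact (convexHull ℝ (T : Set (Space d))) :=
  T.finite_toSet.isCompact_convexHull ℝ

/-- Integrals over the domain of cellwise continuous functions are sums over the cells. -/
theorem integral_domain {F : Space d → ℝ} {G : Finset (Space d) → Space d → ℝ}
    (hG : ∀ T ∈ 𝒯.cells, ContinuousOn (G T) (convexHull ℝ (T : Set (Space d))))
    (hFG : ∀ T ∈ 𝒯.cells, ∀ x ∈ interior (convexHull ℝ (T : Set (Space d))), F x = G T x) :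
    IntegrableOn F 𝒯.domain ∧ ∫ x in 𝒯.domain, F x =
      ∑ T ∈ 𝒯.cellSet, ∫ x in convexHull ℝ (T : Set (Space d)), G T x := by
  -- The frontier of a convex set is null, so values on cell boundaries, where `fderiv` carries no
  -- information, do not matter.
  have hae : ∀ T : Finset (Space d), interior (convexHull ℝ (T : Set (Space d))) =ᵐ[volume]
      convexHull ℝ (T : Set (Space d)) := fun T =>
    interior_ae_eq_of_null_frontier ((convex_convexHull ℝ _).addHaar_frontier volume)
  have hdom : 𝒯.domain =ᵐ[volume]
      ⋃ T ∈ 𝒯.cellSet, interior (convexHull ℝ (T : Set (Space d))) := by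
    rw [domain_eq]
    exact (Filter.EventuallyEq.countable_bUnion (Finset.countable_toSet _) fun T _ => hae T).symm
  have hint : ∀ T ∈ 𝒯.cellSet, IntegrableOn F (interior (convexHull ℝ (T : Set (Space d)))) := by
    intro T hT
    rw [mem_cellSet] at hT
    refine IntegrableOn.congr_fun
      (((hG T hT).integrableOn_compact (isCompact_hull T)).mono_set interior_subset)
      (fun x hx => (hFG T hT x hx).symm) isOpen_interior.measurableSet
  refine ⟨?_, ?_⟩
  · rw [integrableOn_congr_set_ae hdom, integrableOn_finset_iUnion]
    exact hint
  · rw [setIntegral_congr_set hdom, integral_biUnion_finset 𝒯.cellSet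
      (fun _ _ => isOpen_interior.measurableSet)
      (fun T hT T' hT' hne => 𝒯.disjoint_interior (𝒯.mem_cellSet.1 hT) (𝒯.mem_cellSet.1 hT') hne)
      hint]
    refine Finset.sum_congr rfl fun T hT => ?_
    rw [setIntegral_congr_fun isOpen_interior.measurableSet (hFG T (𝒯.mem_cellSet.1 hT)),
      setIntegral_congr_set (hae T)]

open Classical in
/-- The constant part of the affine function that agrees with `φ_i` on the cell `T`. -/
def hatConst (T : Finset (Space d)) (i : 𝒯.Node) : ℝ :=
  if h : T ∈ 𝒯.cells then (𝒯.exists_affine_hat h).choose i else 0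

open Classical in
/-- The gradient of `φ_i` on the cell `T`. -/
def hatGrad (T : Finset (Space d)) (i : 𝒯.Node) : Space d →L[ℝ] ℝ :=
  if h : T ∈ 𝒯.cells then (𝒯.exists_affine_hat h).choose_spec.choose i else 0

open Classical in
theorem hat_spec {T : Finset (Space d)} (hT : T ∈ 𝒯.cells) :
      (∀ x ∈ convexHull ℝ (T : Set (Space d)), ∀ i,
        𝒯.hat i x = 𝒯.hatConst T i + 𝒯.hatGrad T i x) ∧
      (∀ i, 𝒯.pos i ∉ T → 𝒯.hatGrad T i = 0) ∧ ∑ i, 𝒯.hatGrad T i = 0 ∧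
      (∀ x ∈ convexHull ℝ (T : Set (Space d)), (∀ i, 0 ≤ 𝒯.hat i x) ∧ ∑ i, 𝒯.hat i x = 1) ∧
      (∀ i j, 𝒯.pos j ∈ T → 𝒯.hat i (𝒯.pos j) = if i = j then 1 else 0) := by
  simp only [hatConst, hatGrad, dif_pos hT]
  exact (𝒯.exists_affine_hat hT).choose_spec.choose_spec

/-- The constant part of a finite element function on a cell. -/
def feConst (T : Finset (Space d)) (c : 𝒯.Node → V) : V := ∑ i, 𝒯.hatConst T i • c i

/-- The gradient of a finite element function on a cell. -/
def feGrad (T : Finset (Space d)) (c : 𝒯.Node → V) : Space d →L[ℝ] V :=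
  ∑ i, (𝒯.hatGrad T i).smulRight (c i)

theorem feGrad_apply (T : Finset (Space d)) (c : 𝒯.Node → V) (x : Space d) :
    𝒯.feGrad T c x = ∑ i, 𝒯.hatGrad T i x • c i := by
  simp [feGrad, sum_apply]

theorem fe_eq {T : Finset (Space d)} (hT : T ∈ 𝒯.cells) (c : 𝒯.Node → V) {x : Space d}
    (hx : x ∈ convexHull ℝ (T : Set (Space d))) :
    𝒯.fe c x = 𝒯.feConst T c + 𝒯.feGrad T c x := by
  rw [feGrad_apply, feConst, ← Finset.sum_add_distrib, fe]
  refine Finset.sum_congr rfl fun i _ => ?_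
  rw [(𝒯.hat_spec hT).1 x hx i, add_smul]

theorem fe_pos {T : Finset (Space d)} (hT : T ∈ 𝒯.cells) (c : 𝒯.Node → V) {i : 𝒯.Node}
    (hi : 𝒯.pos i ∈ T) : 𝒯.fe c (𝒯.pos i) = c i := by
  classical
  simp [fe, (𝒯.hat_spec hT).2.2.2.2 _ i hi]

theorem fderiv_of_eq_affine {T : Finset (Space d)} {f : Space d → V} {v : V}
    {L : Space d →L[ℝ] V} (h : ∀ x ∈ convexHull ℝ (T : Set (Space d)), f x = v + L x)
    {x : Space d} (hx : x ∈ interior (convexHull ℝ (T : Set (Space d)))) : fderiv ℝ f x = L := by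
  have : f =ᶠ[nhds x] fun y => v + L y :=
    Filter.eventuallyEq_of_mem (mem_interior_iff_mem_nhds.1 hx) h
  rw [this.fderiv_eq, fderiv_const_add, L.fderiv]

theorem gradInner_fe {T : Finset (Space d)} (hT : T ∈ 𝒯.cells) (c c' : 𝒯.Node → V) {x : Space d}
    (hx : x ∈ interior (convexHull ℝ (T : Set (Space d)))) :
    gradInner (𝒯.fe c) (𝒯.fe c') x = hsInner (𝒯.feGrad T c) (𝒯.feGrad T c') := by
  rw [gradInner, hsInner, fderiv_of_eq_affine (fun _ h => 𝒯.fe_eq hT c h) hx,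
    fderiv_of_eq_affine (fun _ h => 𝒯.fe_eq hT c' h) hx]

/-- The volume of a cell. -/
def cellVol (T : Finset (Space d)) : ℝ := volume.real (convexHull ℝ (T : Set (Space d)))

theorem cellVol_nonneg (T : Finset (Space d)) : 0 ≤ cellVol T := measureReal_nonneg

theorem dirichletInner_fe (c c' : 𝒯.Node → V) : dirichletInner 𝒯.domain (𝒯.fe c) (𝒯.fe c') =
    ∑ T ∈ 𝒯.cellSet, cellVol T * hsInner (𝒯.feGrad T c) (𝒯.feGrad T c') := by
  rw [dirichletInner, (𝒯.integral_domain
    (G := fun T _ => hsInner (𝒯.feGrad T c) (𝒯.feGrad T c')) (fun _ _ => continuousOn_const)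
    (fun T hT x hx => 𝒯.gradInner_fe hT c c' hx)).2]
  refine Finset.sum_congr rfl fun T _ => ?_
  rw [setIntegral_const, smul_eq_mul, cellVol]

theorem stiff_eq (i j : 𝒯.Node) : 𝒯.stiff i j =
    -∑ T ∈ 𝒯.cellSet, cellVol T * hsInner (𝒯.hatGrad T i) (𝒯.hatGrad T j) := by
  rw [stiff, dirichletInner, (𝒯.integral_domain
    (G := fun T _ => hsInner (𝒯.hatGrad T i) (𝒯.hatGrad T j)) (fun _ _ => continuousOn_const)
    (fun T hT x hx => ?_)).2]
  · congr 1
    refine Finset.sum_congr rfl fun T _ => ?_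
    rw [setIntegral_const, smul_eq_mul, cellVol]
  · rw [gradInner, hsInner, fderiv_of_eq_affine (fun y h => (𝒯.hat_spec hT).1 y h i) hx,
      fderiv_of_eq_affine (fun y h => (𝒯.hat_spec hT).1 y h j) hx]

theorem stiff_comm (i j : 𝒯.Node) : 𝒯.stiff i j = 𝒯.stiff j i := by
  simp only [stiff_eq, hsInner, real_inner_comm]

/-- The hat functions sum to one, so their gradients cancel on every cell. -/
theorem sum_stiff (i : 𝒯.Node) : ∑ j, 𝒯.stiff i j = 0 := by
  simp only [stiff_eq, Finset.sum_neg_distrib, neg_eq_zero]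
  rw [Finset.sum_comm]
  refine Finset.sum_eq_zero fun T hT => ?_
  have h0 := (𝒯.hat_spec (𝒯.mem_cellSet.1 hT)).2.2.1
  rw [← Finset.mul_sum]
  simp only [hsInner]
  rw [Finset.sum_comm]
  simp_rw [← inner_sum, ← sum_apply, h0]
  simp

/-- Symmetry and zero row sums turn the bilinear form `-∑ k_ij c_i c'_j` into one in differences.
The diagonal, where `k_ii` is not positive, then drops out. -/
theorem dirichletInner_fe_eq_stiff (c c' : 𝒯.Node → ℝ) :
    dirichletInner 𝒯.domain (𝒯.fe c) (𝒯.fe c') =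
      1 / 2 * ∑ i, ∑ j, 𝒯.stiff i j * ((c i - c j) * (c' i - c' j)) := by
  have hbil : dirichletInner 𝒯.domain (𝒯.fe c) (𝒯.fe c') =
      -∑ i, ∑ j, 𝒯.stiff i j * (c i * c' j) := by
    rw [dirichletInner_fe]
    simp only [stiff_eq, neg_mul, Finset.sum_neg_distrib, neg_neg, Finset.sum_mul]
    rw [Finset.sum_congr rfl fun i _ => Finset.sum_comm, Finset.sum_comm]
    refine Finset.sum_congr rfl fun T _ => ?_
    simp only [hsInner, feGrad_apply, sum_inner, inner_sum, Finset.mul_sum, Finset.sum_mul]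
    rw [Finset.sum_comm]
    conv_rhs => rw [Finset.sum_comm]
    refine Finset.sum_congr rfl fun i _ => ?_
    rw [Finset.sum_comm]
    refine Finset.sum_congr rfl fun j _ => Finset.sum_congr rfl fun a _ => ?_
    simp
    ring
  have h1 : ∑ i, ∑ j, 𝒯.stiff i j * (c i * c' i) = 0 := by
    refine Finset.sum_eq_zero fun i _ => ?_
    rw [← Finset.sum_mul, sum_stiff, zero_mul]
  have h2 : ∑ i, ∑ j, 𝒯.stiff i j * (c j * c' j) = 0 := by
    rw [Finset.sum_comm, ← h1]
    exact Finset.sum_congr rfl fun i _ => Finset.sum_congr rfl fun j _ => by rw [stiff_comm]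
  have h3 : ∑ i, ∑ j, 𝒯.stiff i j * (c j * c' i) = ∑ i, ∑ j, 𝒯.stiff i j * (c i * c' j) := by
    rw [Finset.sum_comm]
    exact Finset.sum_congr rfl fun i _ => Finset.sum_congr rfl fun j _ => by rw [stiff_comm]
  have : ∑ i, ∑ j, 𝒯.stiff i j * ((c i - c j) * (c' i - c' j)) =
      ∑ i, ∑ j, 𝒯.stiff i j * (c i * c' i) + ∑ i, ∑ j, 𝒯.stiff i j * (c j * c' j)
      - ∑ i, ∑ j, 𝒯.stiff i j * (c j * c' i) - ∑ i, ∑ j, 𝒯.stiff i j * (c i * c' j) := by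
    simp only [← Finset.sum_add_distrib, ← Finset.sum_sub_distrib]
    exact Finset.sum_congr rfl fun i _ => Finset.sum_congr rfl fun j _ => by ring
  rw [this, h1, h2, h3, hbil]
  ring


/-! ### Consequences of shape regularity and quasi-uniformity. -/

theorem cellDiam_nonneg (T : Finset (Space d)) : 0 ≤ cellDiam T := Metric.diam_nonneg

/-- Moving from the centre of the inscribed ball by its radius `diam T / σ` stays in the cell, where
the hat function takes values in `[0, 1]`. -/
theorem hatGrad_bound {σ : ℝ} (hσ : 0 < σ) (hsr : 𝒯.ShapeRegular σ) {T : Finset (Space d)}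
    (hT : T ∈ 𝒯.cells) (i : 𝒯.Node) (a : Fin d) :
    |𝒯.hatGrad T i (EuclideanSpace.single a 1)| * cellDiam T ≤ σ := by
  obtain ⟨c, hc⟩ := hsr T hT
  have hr : 0 ≤ cellDiam T / σ := div_nonneg (cellDiam_nonneg T) hσ.le
  have m0 : c ∈ convexHull ℝ (T : Set (Space d)) := hc (Metric.mem_closedBall_self hr)
  have m1 : c + (cellDiam T / σ) • EuclideanSpace.single a 1 ∈
      convexHull ℝ (T : Set (Space d)) := by
    apply hc
    rw [mem_closedBall_iff_norm, add_sub_cancel_left, norm_smul, Real.norm_of_nonneg hr]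
    simp
  have bd : ∀ x ∈ convexHull ℝ (T : Set (Space d)), 0 ≤ 𝒯.hat i x ∧ 𝒯.hat i x ≤ 1 := by
    intro x hx
    obtain ⟨h0, h1⟩ := (𝒯.hat_spec hT).2.2.2.1 x hx
    exact ⟨h0 i, h1 ▸ Finset.single_le_sum (fun j _ => h0 j) (Finset.mem_univ i)⟩
  have b0 := bd _ m0
  have b1 := bd _ m1
  rw [(𝒯.hat_spec hT).1 _ m0] at b0
  rw [(𝒯.hat_spec hT).1 _ m1, map_add, map_smul, smul_eq_mul] at b1
  have key : |cellDiam T / σ * 𝒯.hatGrad T i (EuclideanSpace.single a 1)| ≤ 1 := by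
    rw [abs_le]
    constructor <;> linarith [b0.1, b0.2, b1.1, b1.2]
  rw [abs_mul, abs_of_nonneg hr, div_mul_eq_mul_div, div_le_one hσ] at key
  linarith

theorem norm_sub_le_cellDiam {T : Finset (Space d)} {x y : Space d} (hx : x ∈ T) (hy : y ∈ T) :
    ‖x - y‖ ≤ cellDiam T := by
  rw [← dist_eq_norm]
  exact Metric.dist_le_diam_of_mem (isCompact_hull T).isBounded
    (subset_convexHull ℝ _ hx) (subset_convexHull ℝ _ hy)

theorem norm_sub_sq_le {T : Finset (Space d)} (hT : T ∈ 𝒯.cells) (t : 𝒯.Node → V) {i j : 𝒯.Node}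
    (hi : 𝒯.pos i ∈ T) (hj : 𝒯.pos j ∈ T) :
    ‖t i - t j‖ ^ 2 ≤ hsInner (𝒯.feGrad T t) (𝒯.feGrad T t) * cellDiam T ^ 2 := by
  have e : t i - t j = 𝒯.feGrad T t (𝒯.pos i - 𝒯.pos j) := by
    rw [← 𝒯.fe_pos hT t hi, ← 𝒯.fe_pos hT t hj, 𝒯.fe_eq hT t (subset_convexHull ℝ _ hi),
      𝒯.fe_eq hT t (subset_convexHull ℝ _ hj), map_sub]
    abel
  rw [e]
  refine (norm_apply_sq_le_hsInner _ _).trans ?_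
  have := norm_sub_le_cellDiam hi hj
  have := hsInner_self_nonneg (𝒯.feGrad T t)
  gcongr

/-- Hat gradients scale like `σ / diam T`, nodal differences like `diam T` times the gradient of
`t`. The powers of the diameter cancel. -/
theorem neg_hsInner_mul_le {σ : ℝ} (hσ : 0 < σ) (hsr : 𝒯.ShapeRegular σ) {T : Finset (Space d)}
    (hT : T ∈ 𝒯.cells) (t : 𝒯.Node → V) {i j : 𝒯.Node}
    (hi : 𝒯.pos i ∈ T) (hj : 𝒯.pos j ∈ T) :
    -hsInner (𝒯.hatGrad T i) (𝒯.hatGrad T j) * ‖t i - t j‖ ^ 2 ≤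
      d * σ ^ 2 * hsInner (𝒯.feGrad T t) (𝒯.feGrad T t) := by
  have h1 : |hsInner (𝒯.hatGrad T i) (𝒯.hatGrad T j)| * cellDiam T ^ 2 ≤ d * σ ^ 2 := by
    calc |hsInner (𝒯.hatGrad T i) (𝒯.hatGrad T j)| * cellDiam T ^ 2
        ≤ (∑ a, |𝒯.hatGrad T i (EuclideanSpace.single a 1)| *
            |𝒯.hatGrad T j (EuclideanSpace.single a 1)|) * cellDiam T ^ 2 := by
          refine mul_le_mul_of_nonneg_right ?_ (sq_nonneg _)
          refine (Finset.abs_sum_le_sum_abs _ _).trans (Finset.sum_le_sum fun a _ => ?_)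
          simp [abs_mul, mul_comm]
      _ = ∑ a, (|𝒯.hatGrad T i (EuclideanSpace.single a 1)| * cellDiam T) *
            (|𝒯.hatGrad T j (EuclideanSpace.single a 1)| * cellDiam T) := by
          rw [Finset.sum_mul]
          exact Finset.sum_congr rfl fun a _ => by ring
      _ ≤ ∑ _a : Fin d, σ * σ := by
          refine Finset.sum_le_sum fun a _ => ?_
          have := cellDiam_nonneg T
          exact mul_le_mul (𝒯.hatGrad_bound hσ hsr hT i a) (𝒯.hatGrad_bound hσ hsr hT j a)
            (by positivity) hσ.le
      _ = d * σ ^ 2 := by simp [sq]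
  have hg := hsInner_self_nonneg (𝒯.feGrad T t)
  calc -hsInner (𝒯.hatGrad T i) (𝒯.hatGrad T j) * ‖t i - t j‖ ^ 2
      ≤ |hsInner (𝒯.hatGrad T i) (𝒯.hatGrad T j)| *
        (hsInner (𝒯.feGrad T t) (𝒯.feGrad T t) * cellDiam T ^ 2) :=
        mul_le_mul (neg_le_abs _) (𝒯.norm_sub_sq_le hT t hi hj) (sq_nonneg _) (abs_nonneg _)
    _ = |hsInner (𝒯.hatGrad T i) (𝒯.hatGrad T j)| * cellDiam T ^ 2 *
        hsInner (𝒯.feGrad T t) (𝒯.feGrad T t) := by ring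
    _ ≤ _ := mul_le_mul_of_nonneg_right h1 hg

theorem cellVol_mul_norm_sq_le {T : Finset (Space d)} (hT : T ∈ 𝒯.cells) (c : 𝒯.Node → V)
    {i : 𝒯.Node} (hi : 𝒯.pos i ∈ T) : cellVol T * ‖c i‖ ^ 2 ≤ (2 ^ (d + 3) + 2) *
      ∫ x in convexHull ℝ (T : Set (Space d)), ‖𝒯.feConst T c + 𝒯.feGrad T c x‖ ^ 2 := by
  have hi' : 𝒯.pos i ∈ convexHull ℝ (T : Set (Space d)) := subset_convexHull ℝ _ hi
  rw [← 𝒯.fe_pos hT c hi, 𝒯.fe_eq hT c hi']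
  exact measureReal_mul_norm_sq_le (convex_convexHull ℝ _) (isCompact_hull T) hi' _ _

theorem integral_inner_fe (c : 𝒯.Node → V) :
    ∫ x in 𝒯.domain, inner ℝ (𝒯.fe c x) (𝒯.fe c x) = ∑ T ∈ 𝒯.cellSet,
      ∫ x in convexHull ℝ (T : Set (Space d)), ‖𝒯.feConst T c + 𝒯.feGrad T c x‖ ^ 2 := by
  refine (𝒯.integral_domain (G := fun T x => ‖𝒯.feConst T c + 𝒯.feGrad T c x‖ ^ 2)
    (fun T _ => Continuous.continuousOn (by fun_prop)) fun T hT x hx => ?_).2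
  rw [𝒯.fe_eq hT c (interior_subset hx), real_inner_self_eq_norm_sq]

theorem integral_gradInner_mul_fe_sq (s : 𝒯.Node → ℝ) (c : 𝒯.Node → V) :
    ∫ x in 𝒯.domain, gradInner (𝒯.fe c) (𝒯.fe c) x * 𝒯.fe s x ^ 2 = ∑ T ∈ 𝒯.cellSet,
      hsInner (𝒯.feGrad T c) (𝒯.feGrad T c) *
      ∫ x in convexHull ℝ (T : Set (Space d)), ‖𝒯.feConst T s + 𝒯.feGrad T s x‖ ^ 2 := by
  rw [(𝒯.integral_domain (G := fun T x => hsInner (𝒯.feGrad T c) (𝒯.feGrad T c) *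
    ‖𝒯.feConst T s + 𝒯.feGrad T s x‖ ^ 2)
    (fun T _ => Continuous.continuousOn (by fun_prop)) fun T hT x hx => ?_).2]
  · exact Finset.sum_congr rfl fun T _ => integral_const_mul _ _
  · rw [𝒯.fe_eq hT s (interior_subset hx), 𝒯.gradInner_fe hT c c hx, Real.norm_eq_abs, sq_abs]

theorem sum_ite_pos_le {T : Finset (Space d)} (hT : T ∈ 𝒯.cells) [DecidablePred fun i => 𝒯.pos i ∈ T]
    {B : ℝ} (hB : 0 ≤ B) :
    ∑ i, ∑ j, (if 𝒯.pos i ∈ T ∧ 𝒯.pos j ∈ T then B else 0) ≤ ((d : ℝ) + 1) ^ 2 * B := by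
  have hcard : ((Finset.univ.filter fun i => 𝒯.pos i ∈ T).card : ℝ) ≤ d + 1 := by
    have : (Finset.univ.filter fun i => 𝒯.pos i ∈ T).card ≤ T.card :=
      Finset.card_le_card_of_injOn 𝒯.pos (by intro i hi; simpa using hi) 𝒯.pos_injective.injOn
    rw [hT.2] at this
    exact_mod_cast this
  have e : ∑ i, ∑ j, (if 𝒯.pos i ∈ T ∧ 𝒯.pos j ∈ T then B else 0) =
      ((Finset.univ.filter fun i => 𝒯.pos i ∈ T).card : ℝ) ^ 2 * B := by
    simp only [ite_and, Finset.sum_ite_irrel, Finset.sum_const_zero]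
    simp only [← Finset.sum_filter, Finset.sum_const, nsmul_eq_mul]
    ring
  rw [e]
  gcongr

/-- The discrete weighted Dirichlet energy is controlled by the weighted `H¹` seminorm. -/
theorem sum_stiff_mul_norm_sub_sq_le {σ : ℝ} (hσ : 0 < σ) (hsr : 𝒯.ShapeRegular σ)
    (s : 𝒯.Node → ℝ) (t : 𝒯.Node → V) :
    ∑ i, ∑ j, 𝒯.stiff i j * ((s i ^ 2 + s j ^ 2) / 2) * ‖t i - t j‖ ^ 2 ≤
      ((d : ℝ) + 1) ^ 2 * (d * σ ^ 2 * (2 ^ (d + 3) + 2)) *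
        ∫ x in 𝒯.domain, gradInner (𝒯.fe t) (𝒯.fe t) x * 𝒯.fe s x ^ 2 := by
  classical
  set I : Finset (Space d) → ℝ := fun T =>
    ∫ x in convexHull ℝ (T : Set (Space d)), ‖𝒯.feConst T s + 𝒯.feGrad T s x‖ ^ 2 with hI
  set G : Finset (Space d) → ℝ := fun T => hsInner (𝒯.feGrad T t) (𝒯.feGrad T t) with hG
  have hI0 : ∀ T, 0 ≤ I T := fun T => integral_nonneg fun _ => sq_nonneg _
  have hG0 : ∀ T, 0 ≤ G T := fun T => hsInner_self_nonneg _
  -- The bound holds cell by cell whatever the sign of the local stiffness entry; weak acuteness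
  -- only fixes the sign of the sum over cells. The weights `s_i²` are compared with the integral of
  -- `s_h²` over the cell.
  have hpt : ∀ T ∈ 𝒯.cellSet, ∀ i j,
      -(cellVol T * hsInner (𝒯.hatGrad T i) (𝒯.hatGrad T j)) * ((s i ^ 2 + s j ^ 2) / 2) *
        ‖t i - t j‖ ^ 2 ≤
      if 𝒯.pos i ∈ T ∧ 𝒯.pos j ∈ T then d * σ ^ 2 * (2 ^ (d + 3) + 2) * (G T * I T) else 0 := by
    intro T hT i j
    rw [mem_cellSet] at hT
    split_ifs with h
    · have h1 := 𝒯.neg_hsInner_mul_le hσ hsr hT t h.1 h.2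
      have h2 := 𝒯.cellVol_mul_norm_sq_le hT s h.1
      have h3 := 𝒯.cellVol_mul_norm_sq_le hT s h.2
      rw [Real.norm_eq_abs, sq_abs] at h2 h3
      have h4 : cellVol T * ((s i ^ 2 + s j ^ 2) / 2) ≤ (2 ^ (d + 3) + 2) * I T := by
        simp only [hI]
        linarith
      have h5 : 0 ≤ cellVol T * ((s i ^ 2 + s j ^ 2) / 2) :=
        mul_nonneg (cellVol_nonneg T) (by positivity)
      have h6 : 0 ≤ d * σ ^ 2 * G T := mul_nonneg (by positivity) (hG0 T)
      calc _ = (-hsInner (𝒯.hatGrad T i) (𝒯.hatGrad T j) * ‖t i - t j‖ ^ 2) *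
            (cellVol T * ((s i ^ 2 + s j ^ 2) / 2)) := by ring
        _ ≤ (d * σ ^ 2 * G T) * (cellVol T * ((s i ^ 2 + s j ^ 2) / 2)) :=
            mul_le_mul_of_nonneg_right h1 h5
        _ ≤ (d * σ ^ 2 * G T) * ((2 ^ (d + 3) + 2) * I T) := mul_le_mul_of_nonneg_left h4 h6
        _ = _ := by ring
    · have h0 := (𝒯.hat_spec hT).2.1
      have : hsInner (𝒯.hatGrad T i) (𝒯.hatGrad T j) = 0 := by
        rw [not_and_or] at h
        rcases h with h | h <;> simp [hsInner, h0 _ h]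
      simp [this]
  calc _ = ∑ T ∈ 𝒯.cellSet, ∑ i, ∑ j, -(cellVol T * hsInner (𝒯.hatGrad T i) (𝒯.hatGrad T j)) *
        ((s i ^ 2 + s j ^ 2) / 2) * ‖t i - t j‖ ^ 2 := by
        simp only [stiff_eq, ← Finset.sum_neg_distrib, Finset.sum_mul]
        rw [Finset.sum_congr rfl fun i _ => Finset.sum_comm, Finset.sum_comm]
    _ ≤ ∑ T ∈ 𝒯.cellSet, ((d : ℝ) + 1) ^ 2 * (d * σ ^ 2 * (2 ^ (d + 3) + 2) * (G T * I T)) := by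
        refine Finset.sum_le_sum fun T hT => ?_
        refine (Finset.sum_le_sum fun i _ => Finset.sum_le_sum fun j _ => hpt T hT i j).trans ?_
        exact 𝒯.sum_ite_pos_le (𝒯.mem_cellSet.1 hT)
          (mul_nonneg (by positivity) (mul_nonneg (hG0 T) (hI0 T)))
    _ = _ := by
        rw [integral_gradInner_mul_fe_sq, Finset.mul_sum]
        exact Finset.sum_congr rfl fun T _ => by simp only [hG, hI]; ring

theorem exists_cell_of_node (i : 𝒯.Node) : ∃ T ∈ 𝒯.cells, 𝒯.pos i ∈ T := by
  obtain ⟨T, hT, hsub, hc⟩ := 𝒯.pure _ i.2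
  exact ⟨T, ⟨hT, hc⟩, hsub (Finset.mem_singleton_self _)⟩

theorem le_cellVol {σ : ℝ} (hσ : 0 < σ) (hsr : 𝒯.ShapeRegular σ) {T : Finset (Space d)}
    (hT : T ∈ 𝒯.cells) :
    (cellDiam T / σ) ^ d * volume.real (Metric.ball (0 : Space d) 1) ≤ cellVol T := by
  obtain ⟨c, hc⟩ := hsr T hT
  have h := Measure.addHaar_real_closedBall (volume : Measure (Space d)) c
    (div_nonneg (cellDiam_nonneg T) hσ.le)
  rw [finrank_euclideanSpace, Fintype.card_fin] at h
  rw [← h]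
  exact measureReal_mono hc (isCompact_hull T).measure_lt_top.ne

theorem meshSize_nonneg : 0 ≤ 𝒯.meshSize :=
  Real.sSup_nonneg (by rintro _ ⟨T, -, rfl⟩; exact cellDiam_nonneg T)

/-- Inverse estimate between the maximum norm and the `L²` norm. -/
theorem norm_sq_le_integral {σ γ : ℝ} (hσ : 0 < σ) (hγ : 0 < γ) (hsr : 𝒯.ShapeRegular σ)
    (hqu : 𝒯.QuasiUniform γ) (t : 𝒯.Node → V) (i : 𝒯.Node) :
    volume.real (Metric.ball (0 : Space d) 1) / (γ * σ) ^ d * 𝒯.meshSize ^ d * ‖t i‖ ^ 2 ≤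
      (2 ^ (d + 3) + 2) * ∫ x in 𝒯.domain, inner ℝ (𝒯.fe t x) (𝒯.fe t x) := by
  obtain ⟨T, hT, hi⟩ := 𝒯.exists_cell_of_node i
  -- Quasi-uniformity replaces the local diameter by `h`, so that one power `h^d` serves all nodes.
  have h1 : (𝒯.meshSize / (γ * σ)) ^ d ≤ (cellDiam T / σ) ^ d := by
    have := 𝒯.meshSize_nonneg
    refine pow_le_pow_left₀ (by positivity) ?_ d
    rw [div_le_div_iff₀ (by positivity) hσ]
    have := hqu T hT
    nlinarith
  have h2 : ∫ x in convexHull ℝ (T : Set (Space d)), ‖𝒯.feConst T t + 𝒯.feGrad T t x‖ ^ 2 ≤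
      ∫ x in 𝒯.domain, inner ℝ (𝒯.fe t x) (𝒯.fe t x) := by
    rw [integral_inner_fe]
    exact Finset.single_le_sum (f := fun T : Finset (Space d) =>
      ∫ x in convexHull ℝ (T : Set (Space d)), ‖𝒯.feConst T t + 𝒯.feGrad T t x‖ ^ 2)
      (fun T _ => integral_nonneg fun _ => sq_nonneg _) (𝒯.mem_cellSet.2 hT)
  calc _ = (𝒯.meshSize / (γ * σ)) ^ d * volume.real (Metric.ball (0 : Space d) 1) * ‖t i‖ ^ 2 := by
        rw [div_pow]; ring
    _ ≤ (cellDiam T / σ) ^ d * volume.real (Metric.ball (0 : Space d) 1) * ‖t i‖ ^ 2 := by gcongr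
    _ ≤ cellVol T * ‖t i‖ ^ 2 := by
        gcongr
        exact 𝒯.le_cellVol hσ hsr hT
    _ ≤ _ := 𝒯.cellVol_mul_norm_sq_le hT t hi
    _ ≤ _ := by gcongr

theorem weightedInner_fe_self_bounds (s : 𝒯.Node → ℝ) (t : 𝒯.Node → V) :
    0 ≤ (∫ x in 𝒯.domain, inner ℝ (𝒯.fe t x) (𝒯.fe t x)) ∧
    0 ≤ ∫ x in 𝒯.domain, gradInner (𝒯.fe t) (𝒯.fe t) x * 𝒯.fe s x ^ 2 := by
  refine ⟨integral_nonneg fun _ => real_inner_self_nonneg, integral_nonneg fun x => ?_⟩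
  exact mul_nonneg (Finset.sum_nonneg fun _ _ => real_inner_self_nonneg) (sq_nonneg _)

end Mesh

/-! ### Algebra of line fields and the nodal projection. -/

section Frobenius

variable {d : ℕ}

theorem frob_comm (A B : Matrix (Fin d) (Fin d) ℝ) : frob A B = frob B A := by
  simp only [frob, mul_comm]

theorem frob_add_left (A B C : Matrix (Fin d) (Fin d) ℝ) :
    frob (A + B) C = frob A C + frob B C := by
  simp only [frob, Matrix.add_apply, add_mul, Finset.sum_add_distrib]

theorem frob_sub_left (A B C : Matrix (Fin d) (Fin d) ℝ) :
    frob (A - B) C = frob A C - frob B C := by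
  simp only [frob, Matrix.sub_apply, sub_mul, Finset.sum_sub_distrib]

theorem frob_smul_left (r : ℝ) (A B : Matrix (Fin d) (Fin d) ℝ) :
    frob (r • A) B = r * frob A B := by
  simp only [frob, Matrix.smul_apply, smul_eq_mul, mul_assoc, Finset.mul_sum]

theorem frob_add_right (A B C : Matrix (Fin d) (Fin d) ℝ) :
    frob A (B + C) = frob A B + frob A C := by
  rw [frob_comm, frob_add_left, frob_comm B, frob_comm C]

theorem frob_sub_right (A B C : Matrix (Fin d) (Fin d) ℝ) :
    frob A (B - C) = frob A B - frob A C := by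
  rw [frob_comm, frob_sub_left, frob_comm B, frob_comm C]

theorem frob_smul_right (r : ℝ) (A B : Matrix (Fin d) (Fin d) ℝ) :
    frob A (r • B) = r * frob A B := by
  rw [frob_comm, frob_smul_left, frob_comm]

theorem frob_self_nonneg (A : Matrix (Fin d) (Fin d) ℝ) : 0 ≤ frob A A :=
  Finset.sum_nonneg fun _ _ => Finset.sum_nonneg fun _ _ => mul_self_nonneg _

theorem frob_zero_left (A : Matrix (Fin d) (Fin d) ℝ) : frob 0 A = 0 := by simp [frob]

theorem frob_outer (a b c e : Space d) :
    frob (outer a b) (outer c e) = inner ℝ a c * inner ℝ b e := by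
  simp only [frob, outer, Matrix.of_apply, PiLp.inner_apply, Finset.sum_mul_sum,
    RCLike.inner_apply, conj_trivial]
  exact Finset.sum_congr rfl fun _ _ => Finset.sum_congr rfl fun _ _ => by ring

theorem outer_add_left (a b c : Space d) : outer (a + b) c = outer a c + outer b c := by
  ext i j; simp [outer, add_mul]

theorem outer_add_right (a b c : Space d) : outer a (b + c) = outer a b + outer a c := by
  ext i j; simp [outer, mul_add]

theorem outer_smul_smul (r : ℝ) (a : Space d) : outer (r • a) (r • a) = r ^ 2 • outer a a := by
  ext i j; simp [outer]; ring

/-- Projecting directors of length at least one onto the sphere does not increase the distance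
of the line fields. -/
theorem frob_sub_normalize_le {m m' : Space d} (hm : 1 ≤ ‖m‖) (hm' : 1 ≤ ‖m'‖) :
    frob (outer (‖m‖⁻¹ • m) (‖m‖⁻¹ • m) - outer (‖m'‖⁻¹ • m') (‖m'‖⁻¹ • m'))
      (outer (‖m‖⁻¹ • m) (‖m‖⁻¹ • m) - outer (‖m'‖⁻¹ • m') (‖m'‖⁻¹ • m')) ≤
    frob (outer m m - outer m' m') (outer m m - outer m' m') := by
  simp only [outer_smul_smul, frob_sub_left, frob_sub_right, frob_smul_left, frob_smul_right,
    frob_outer, real_inner_self_eq_norm_sq, real_inner_comm m m']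
  set a := ‖m‖
  set b := ‖m'‖
  set e : ℝ := inner ℝ m m'
  have ha : 0 < a := by linarith
  have hb : 0 < b := by linarith
  have he : e * e ≤ (a * b) ^ 2 := by
    have := abs_real_inner_le_norm m m'
    rw [← abs_mul_abs_self e, sq]
    exact mul_self_le_mul_self (abs_nonneg _) this
  have hx : e * e / (a * b) ^ 2 ≤ 1 := (div_le_one (by positivity)).2 he
  have hab : 1 ≤ (a * b) ^ 2 := by
    have : 1 ≤ a * b := by nlinarith
    nlinarith
  -- `x` is the squared cosine of the angle between the directors. The normalized distance squared
  -- is `2 - 2x`; the original one is `(a² - b²)² + 2 (1 - x) (ab)²`, and `ab ≥ 1`.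
  set x := e * e / (a * b) ^ 2 with hxdef
  have hex : e * e = x * (a * b) ^ 2 := by rw [hxdef]; field_simp
  have hl : a⁻¹ ^ 2 * (a⁻¹ ^ 2 * (a ^ 2 * a ^ 2)) - b⁻¹ ^ 2 * (a⁻¹ ^ 2 * (e * e)) -
      (a⁻¹ ^ 2 * (b⁻¹ ^ 2 * (e * e)) - b⁻¹ ^ 2 * (b⁻¹ ^ 2 * (b ^ 2 * b ^ 2))) = 2 - 2 * x := by
    rw [hex]; field_simp; ring
  refine le_trans (le_of_eq ?_) (le_trans (b := 2 - 2 * x) le_rfl ?_)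
  · rw [← hl]; ring
  · have : 0 ≤ (1 - x) * ((a * b) ^ 2 - 1) := mul_nonneg (by linarith) (by linarith)
    rw [hex]
    nlinarith [sq_nonneg (a ^ 2 - b ^ 2)]

/-- Change of the squared distance of two line fields under a tangential update followed by the
projection onto the sphere. -/
theorem frob_sub_projection_le {n n' t t' : Space d} (hn : ‖n‖ = 1) (hn' : ‖n'‖ = 1)
    (ht : inner ℝ t n = 0) (ht' : inner ℝ t' n' = 0)
    {Θ Θ' T T' : Matrix (Fin d) (Fin d) ℝ} (hΘ : Θ = outer n n) (hΘ' : Θ' = outer n' n')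
    (hT : T = outer n t + outer t n) (hT' : T' = outer n' t' + outer t' n') :
    frob (outer (‖n + t‖⁻¹ • (n + t)) (‖n + t‖⁻¹ • (n + t)) -
        outer (‖n' + t'‖⁻¹ • (n' + t')) (‖n' + t'‖⁻¹ • (n' + t')))
      (outer (‖n + t‖⁻¹ • (n + t)) (‖n + t‖⁻¹ • (n + t)) -
        outer (‖n' + t'‖⁻¹ • (n' + t')) (‖n' + t'‖⁻¹ • (n' + t'))) ≤
    frob (Θ - Θ') (Θ - Θ') + 2 * frob ((Θ + T) - (Θ' + T')) (T - T')
      - 1 / 2 * frob (T - T') (T - T') + 3 * (2 * (‖t‖ ^ 2 + ‖t'‖ ^ 2) * ‖t - t'‖ ^ 2) := by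
  have hlen : ∀ {n t : Space d}, ‖n‖ = 1 → inner ℝ t n = 0 → 1 ≤ ‖n + t‖ := by
    intro n t hn ht
    have h := norm_add_sq_real n t
    rw [real_inner_comm] at ht
    rw [hn, ht] at h
    nlinarith [norm_nonneg (n + t), sq_nonneg ‖t‖]
  refine (frob_sub_normalize_le (hlen hn ht) (hlen hn' ht')).trans ?_
  set Q := outer t t with hQ
  set Q' := outer t' t' with hQ'
  have e1 : outer (n + t) (n + t) = Θ + T + Q := by
    rw [hΘ, hT, outer_add_left, outer_add_right, outer_add_right]; abel
  have e2 : outer (n' + t') (n' + t') = Θ' + T' + Q' := by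
    rw [hΘ', hT', outer_add_left, outer_add_right, outer_add_right]; abel
  -- Tangency removes the terms `(n·t)²` and `(n'·t')²`, leaving `-(n·t')² - (n'·t)²`. This sign
  -- removes the term linear in `Q`.
  have hPQ : frob (Θ - Θ') (Q - Q') ≤ 0 := by
    rw [hΘ, hΘ', hQ, hQ']
    simp only [frob_sub_left, frob_sub_right, frob_outer]
    rw [real_inner_comm t n, ht, real_inner_comm t' n', ht']
    nlinarith [mul_self_nonneg (inner ℝ n t' : ℝ), mul_self_nonneg (inner ℝ n' t : ℝ)]
  have hQQ : frob (Q - Q') (Q - Q') ≤ 2 * (‖t‖ ^ 2 + ‖t'‖ ^ 2) * ‖t - t'‖ ^ 2 := by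
    have e : Q - Q' = outer t (t - t') + outer (t - t') t' := by
      ext i j; simp [hQ, hQ', outer]; ring
    -- This yields `|X + Y|² ≤ 2|X|² + 2|Y|²` for the two summands of `Q - Q'`.
    have h := frob_self_nonneg (outer t (t - t') - outer (t - t') t')
    rw [e]
    simp only [frob_sub_left, frob_sub_right, frob_add_left, frob_add_right, frob_outer,
      real_inner_self_eq_norm_sq] at h ⊢
    linarith
  -- Young's inequality, weighted so that half of the available `-|T - T'|²` survives to absorb the
  -- error. The `2` here and the square of `Q - Q'` itself make the final factor `3`.
  have hTQ : 2 * frob (T - T') (Q - Q') ≤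
      1 / 2 * frob (T - T') (T - T') + 2 * frob (Q - Q') (Q - Q') := by
    have h := frob_self_nonneg ((T - T') - (2 : ℝ) • (Q - Q'))
    generalize T - T' = A at *
    generalize Q - Q' = B at *
    simp only [frob_sub_left, frob_sub_right, frob_smul_left, frob_smul_right] at h
    rw [frob_comm B A] at h
    linarith
  have e3 : outer (n + t) (n + t) - outer (n' + t') (n' + t') = (Θ - Θ') + (T - T') + (Q - Q') := by
    rw [e1, e2]; abel
  have e4 : (Θ + T) - (Θ' + T') = (Θ - Θ') + (T - T') := by abel
  rw [e3, e4]
  generalize Θ - Θ' = P at *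
  generalize T - T' = A at *
  generalize Q - Q' = B at *
  simp only [frob_add_left, frob_add_right]
  rw [frob_comm A P, frob_comm B P, frob_comm B A]
  linarith

end Frobenius

/-! ### Convex splitting of the bulk potential. -/

theorem _root_.ConvexOn.add_mul_sub_le {S : Set ℝ} {f : ℝ → ℝ} (hf : ConvexOn ℝ S f) {x y f' : ℝ}
    (hx : x ∈ S) (hy : y ∈ S) (h : HasDerivWithinAt f f' S x) : f x + f' * (y - x) ≤ f y := by
  rcases lt_trichotomy x y with hxy | rfl | hxy
  · have := hf.le_slope_of_hasDerivWithinAt hx hy hxy h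
    rw [slope_def_field, le_div_iff₀ (sub_pos.2 hxy)] at this
    linarith
  · simp
  · have := hf.slope_le_of_hasDerivWithinAt hy hx hxy h
    rw [slope_def_field, div_le_iff₀ (sub_pos.2 hxy)] at this
    linarith

namespace Mesh

variable {d : ℕ} (𝒯 : Mesh d)

theorem fe_sub {V : Type*} [AddCommGroup V] [Module ℝ V] (c c' : 𝒯.Node → V) (x : Space d) :
    𝒯.fe (c - c') x = 𝒯.fe c x - 𝒯.fe c' x := by
  simp [fe, smul_sub]

/-- Values on a cell are convex combinations of nodal values. The potential is therefore evaluated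
only inside its domain. -/
theorem fe_mem {S : Set ℝ} (hS : Convex ℝ S) {s : 𝒯.Node → ℝ} (hs : ∀ i, s i ∈ S)
    {T : Finset (Space d)} (hT : T ∈ 𝒯.cells) {x : Space d}
    (hx : x ∈ convexHull ℝ (T : Set (Space d))) : 𝒯.fe s x ∈ S := by
  obtain ⟨h0, h1⟩ := (𝒯.hat_spec hT).2.2.2.1 x hx
  exact hS.sum_mem (fun i _ => h0 i) h1 fun i _ => hs i

theorem continuousOn_fe {V : Type*} [NormedAddCommGroup V] [InnerProductSpace ℝ V]
    (c : 𝒯.Node → V) {T : Finset (Space d)} (hT : T ∈ 𝒯.cells) :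
    ContinuousOn (𝒯.fe c) (convexHull ℝ (T : Set (Space d))) :=
  ContinuousOn.congr (f := fun x => 𝒯.feConst T c + 𝒯.feGrad T c x)
    (Continuous.continuousOn (by fun_prop)) fun _ hx => 𝒯.fe_eq hT c hx

theorem integrableOn_domain {F : Space d → ℝ}
    (hF : ∀ T ∈ 𝒯.cells, ContinuousOn F (convexHull ℝ (T : Set (Space d)))) :
    IntegrableOn F 𝒯.domain :=
  (𝒯.integral_domain (G := fun _ => F) hF fun _ _ _ _ => rfl).1

theorem exists_cell_of_mem_domain {x : Space d} (hx : x ∈ 𝒯.domain) :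
    ∃ T ∈ 𝒯.cells, x ∈ convexHull ℝ (T : Set (Space d)) := by
  rw [domain_eq] at hx
  simpa [mem_cellSet] using hx

theorem measurableSet_domain : MeasurableSet 𝒯.domain := by
  rw [domain_eq]
  exact Finset.measurableSet_biUnion _ fun T _ => (isCompact_hull T).measurableSet

end Mesh

section Bulk

variable {d : ℕ} (𝒯 : Mesh d) (ψ : SplitPotential)

theorem SplitPotential.continuousOn_c : ContinuousOn ψ.ψc ψ.dom := fun r hr =>
  (ψ.deriv_c r hr).continuousWithinAt

theorem SplitPotential.continuousOn_e : ContinuousOn ψ.ψe ψ.dom := fun r hr =>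
  (ψ.deriv_e r hr).continuousWithinAt

theorem bulkEnergy_nonneg {ηB : ℝ} (hη : 0 < ηB) {s : 𝒯.Node → ℝ} (hs : ∀ i, s i ∈ ψ.dom) :
    0 ≤ bulkEnergy 𝒯 ψ ηB s := by
  refine mul_nonneg (by positivity) (setIntegral_nonneg 𝒯.measurableSet_domain fun x hx => ?_)
  obtain ⟨T, hT, hxT⟩ := 𝒯.exists_cell_of_mem_domain hx
  exact ψ.nonneg _ (𝒯.fe_mem ψ.convex_c.1 hs hT hxT)

/-- Convex splitting. -/
theorem bulkEnergy_sub_le {ηB : ℝ} (hη : 0 < ηB) {s s' : 𝒯.Node → ℝ} (hs : ∀ i, s i ∈ ψ.dom)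
    (hs' : ∀ i, s' i ∈ ψ.dom) : bulkEnergy 𝒯 ψ ηB s' - bulkEnergy 𝒯 ψ ηB s ≤
      1 / ηB * ∫ x in 𝒯.domain,
        (ψ.dψc (𝒯.fe s' x) - ψ.dψe (𝒯.fe s x)) * 𝒯.fe (s' - s) x := by
  have cont : ∀ {f : ℝ → ℝ} {c : 𝒯.Node → ℝ}, ContinuousOn f ψ.dom → (∀ i, c i ∈ ψ.dom) →
      ∀ T ∈ 𝒯.cells, ContinuousOn (fun x => f (𝒯.fe c x)) (convexHull ℝ (T : Set (Space d))) :=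
    fun hf hc T hT => hf.comp (𝒯.continuousOn_fe _ hT)
      fun _ hx => 𝒯.fe_mem ψ.convex_c.1 hc hT hx
  have i1 : ∀ {c : 𝒯.Node → ℝ}, (∀ i, c i ∈ ψ.dom) →
      IntegrableOn (fun x => ψ.ψc (𝒯.fe c x) - ψ.ψe (𝒯.fe c x)) 𝒯.domain := fun hc =>
    𝒯.integrableOn_domain fun T hT =>
      (cont ψ.continuousOn_c hc T hT).sub (cont ψ.continuousOn_e hc T hT)
  rw [bulkEnergy, bulkEnergy, ← mul_sub, ← integral_sub (i1 hs') (i1 hs)]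
  refine mul_le_mul_of_nonneg_left ?_ (by positivity)
  refine setIntegral_mono_on ((i1 hs').sub (i1 hs)) (𝒯.integrableOn_domain fun T hT =>
    ((cont ψ.cont_c hs' T hT).sub (cont ψ.cont_e hs T hT)).mul (𝒯.continuousOn_fe _ hT))
    𝒯.measurableSet_domain fun x hx => ?_
  obtain ⟨T, hT, hxT⟩ := 𝒯.exists_cell_of_mem_domain hx
  have m := 𝒯.fe_mem ψ.convex_c.1 hs hT hxT
  have m' := 𝒯.fe_mem ψ.convex_c.1 hs' hT hxT
  -- The tangent of `ψc` is taken at the new value and that of `ψe` at the old one, matching the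
  -- implicit and explicit parts of the scheme.
  have hc := ψ.convex_c.add_mul_sub_le m' m (ψ.deriv_c _ m')
  have he := ψ.convex_e.add_mul_sub_le m m' (ψ.deriv_e _ m)
  rw [𝒯.fe_sub]
  linarith

end Bulk


/-! ### The discrete energy as a quadratic form. -/

variable {d : ℕ} (𝒯 : Mesh d)

/-- Only off-diagonal weights are known to be nonnegative. Equality is therefore required on the
diagonal, where in all uses both sides vanish. -/
theorem Mesh.WeaklyAcute.sum_le {𝒯 : Mesh d} (hwa : 𝒯.WeaklyAcute) {w x y : 𝒯.Node → 𝒯.Node → ℝ}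
    (hw : ∀ i j, 0 ≤ w i j) (hxy : ∀ i j, x i j ≤ y i j) (hd : ∀ i, x i i = y i i) :
    ∑ i, ∑ j, 𝒯.stiff i j * w i j * x i j ≤ ∑ i, ∑ j, 𝒯.stiff i j * w i j * y i j := by
  refine Finset.sum_le_sum fun i _ => Finset.sum_le_sum fun j _ => ?_
  by_cases h : i = j
  · subst h
    rw [hd]
  · exact mul_le_mul_of_nonneg_left (hxy i j) (mul_nonneg (hwa i j h) (hw i j))

theorem Mesh.WeaklyAcute.sum_nonneg {𝒯 : Mesh d} (hwa : 𝒯.WeaklyAcute)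
    {w x : 𝒯.Node → 𝒯.Node → ℝ} (hw : ∀ i j, 0 ≤ w i j) (hx : ∀ i j, 0 ≤ x i j)
    (hd : ∀ i, x i i = 0) : 0 ≤ ∑ i, ∑ j, 𝒯.stiff i j * w i j * x i j := by
  have := hwa.sum_le hw hx (fun i => (hd i).symm)
  simpa using this

theorem weight_nonneg (s : 𝒯.Node → ℝ) (i j : 𝒯.Node) : 0 ≤ (s i ^ 2 + s j ^ 2) / 2 := by
  positivity

section Form

variable (s : 𝒯.Node → ℝ) (A B C : 𝒯.Node → Matrix (Fin d) (Fin d) ℝ)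

theorem ringVarTheta_comm : ringVarTheta 𝒯 s A B = ringVarTheta 𝒯 s B A := by
  simp only [ringVarTheta]
  exact Finset.sum_congr rfl fun i _ => Finset.sum_congr rfl fun j _ => by rw [frob_comm]

theorem ringVarTheta_add_left :
    ringVarTheta 𝒯 s (A + B) C = ringVarTheta 𝒯 s A C + ringVarTheta 𝒯 s B C := by
  simp only [ringVarTheta, ← Finset.sum_add_distrib, Pi.add_apply]
  refine Finset.sum_congr rfl fun i _ => Finset.sum_congr rfl fun j _ => ?_
  rw [add_sub_add_comm, frob_add_left]
  ring

theorem ringVarTheta_smul_left (r : ℝ) :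
    ringVarTheta 𝒯 s (r • A) B = r * ringVarTheta 𝒯 s A B := by
  simp only [ringVarTheta, Finset.mul_sum, Pi.smul_apply]
  refine Finset.sum_congr rfl fun i _ => Finset.sum_congr rfl fun j _ => ?_
  rw [← smul_sub, frob_smul_left]
  ring

variable {𝒯}

theorem ringVarTheta_self_nonneg (hwa : 𝒯.WeaklyAcute) : 0 ≤ ringVarTheta 𝒯 s A A :=
  hwa.sum_nonneg (weight_nonneg 𝒯 s) (fun _ _ => frob_self_nonneg _)
    fun i => by rw [sub_self, frob_zero_left]

/-- Cauchy-Schwarz for a semidefinite form, from the discriminant of `x ↦ a(A + xB, A + xB)`. -/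
theorem sq_ringVarTheta_le (hwa : 𝒯.WeaklyAcute) :
    ringVarTheta 𝒯 s A B ^ 2 ≤ ringVarTheta 𝒯 s A A * ringVarTheta 𝒯 s B B := by
  have h : ∀ x : ℝ, 0 ≤ ringVarTheta 𝒯 s B B * (x * x) + 2 * ringVarTheta 𝒯 s A B * x +
      ringVarTheta 𝒯 s A A := by
    intro x
    have h := ringVarTheta_self_nonneg s (A + x • B) hwa
    rw [ringVarTheta_add_left, ringVarTheta_smul_left, ringVarTheta_comm 𝒯 s A,
      ringVarTheta_comm 𝒯 s B, ringVarTheta_add_left, ringVarTheta_add_left,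
      ringVarTheta_smul_left, ringVarTheta_smul_left, ringVarTheta_comm 𝒯 s B A] at h
    linarith
  have := discrim_le_zero h
  rw [discrim] at this
  linarith

end Form

theorem mainEnergy_eq (s : 𝒯.Node → ℝ) (Θ : 𝒯.Node → Matrix (Fin d) (Fin d) ℝ) :
    mainEnergy 𝒯 s Θ = ((d : ℝ) - 1) / (4 * d) * (∑ i, ∑ j, 𝒯.stiff i j * (s i - s j) ^ 2) +
      1 / 4 * ringVarTheta 𝒯 s Θ Θ := rfl

variable {𝒯}

theorem ringVarTheta_le_mainEnergy (hwa : 𝒯.WeaklyAcute) (hd : 1 ≤ d) (s : 𝒯.Node → ℝ)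
    (Θ : 𝒯.Node → Matrix (Fin d) (Fin d) ℝ) :
    ringVarTheta 𝒯 s Θ Θ ≤ 4 * mainEnergy 𝒯 s Θ := by
  have h := hwa.sum_nonneg (w := fun _ _ => 1) (x := fun i j => (s i - s j) ^ 2)
    (fun _ _ => zero_le_one) (fun _ _ => sq_nonneg _) (fun i => by simp)
  simp only [mul_one] at h
  have hd' : (0 : ℝ) ≤ ((d : ℝ) - 1) / (4 * d) := by
    have : (1 : ℝ) ≤ d := by exact_mod_cast hd
    exact div_nonneg (by linarith) (by linarith)
  rw [mainEnergy_eq]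
  linarith [mul_nonneg hd' h]

/-! ### Energy decrease in one time step. -/

/-- The constant in the stability restriction on the time step. -/
def stepConst (d : ℕ) (σ γ μ Emax : ℝ) : ℝ :=
  96 * (2 ^ (d + 3) + 2) * (((d : ℝ) + 1) ^ 2 * (d * σ ^ 2 * (2 ^ (d + 3) + 2))) * μ ^ 2 * |Emax| /
    (volume.real (Metric.ball (0 : Space d) 1) / (γ * σ) ^ d) + 1

theorem volume_unitBall_pos (d : ℕ) : 0 < volume.real (Metric.ball (0 : Space d) 1) :=
  ENNReal.toReal_pos (Metric.measure_ball_pos volume _ one_pos).ne' measure_ball_lt_top.ne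

theorem stepConst_pos (d : ℕ) {σ γ : ℝ} (hσ : 0 < σ) (hγ : 0 < γ) (μ Emax : ℝ) :
    0 < stepConst d σ γ μ Emax := by
  have := volume_unitBall_pos d
  rw [stepConst]
  positivity

/-- The weighted tangent flow followed by the nodal projection decreases the energy. -/
theorem mainEnergy_projection_le {σ γ μ δt Emax : ℝ} (hd : 1 ≤ d) (hσ : 0 < σ) (hγ : 0 < γ)
    (hμ : 0 < μ) (hδt : 0 < δt) (hsr : 𝒯.ShapeRegular σ) (hqu : 𝒯.QuasiUniform γ)
    (hwa : 𝒯.WeaklyAcute) (hh : 0 < 𝒯.meshSize)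
    (hstep : stepConst d σ γ μ Emax * δt ^ 2 ≤ 𝒯.meshSize ^ d)
    {s : 𝒯.Node → ℝ} {n n' t : 𝒯.Node → Space d} (hn : ∀ i, ‖n i‖ = 1)
    (ht : ∀ i, inner ℝ (t i) (n i) = 0)
    (hE : mainEnergy 𝒯 s (lineOf 𝒯 n) ≤ Emax)
    (hflow : 1 / δt * weightedInner 𝒯.domain (fun x => 𝒯.fe s x ^ 2) (𝒯.fe t) (𝒯.fe t) =
      -(μ * ringVarTheta 𝒯 s (lineOf 𝒯 n + tangentTensor 𝒯 n t) (tangentTensor 𝒯 n t)))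
    (hproj : ∀ i, outer (n' i) (n' i) =
      outer (‖n i + t i‖⁻¹ • (n i + t i)) (‖n i + t i‖⁻¹ • (n i + t i))) :
    mainEnergy 𝒯 s (lineOf 𝒯 n') + 1 / δt * (1 / (2 * μ) *
      weightedInner 𝒯.domain (fun x => 𝒯.fe s x ^ 2) (𝒯.fe t) (𝒯.fe t)) ≤
      mainEnergy 𝒯 s (lineOf 𝒯 n) := by
  obtain ⟨hW1, hW2⟩ := 𝒯.weightedInner_fe_self_bounds s t
  have hinv := 𝒯.norm_sq_le_integral hσ hγ hsr hqu t
  have hdir := 𝒯.sum_stiff_mul_norm_sub_sq_le hσ hsr s t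
  set W := weightedInner 𝒯.domain (fun x => 𝒯.fe s x ^ 2) (𝒯.fe t) (𝒯.fe t) with hW
  have hWsum : W = (∫ x in 𝒯.domain, inner ℝ (𝒯.fe t x) (𝒯.fe t x)) +
    ∫ x in 𝒯.domain, gradInner (𝒯.fe t) (𝒯.fe t) x * 𝒯.fe s x ^ 2 := rfl
  set Θ := lineOf 𝒯 n
  set T := tangentTensor 𝒯 n t
  set A2 := ringVarTheta 𝒯 s T T with hA2
  have hA2nn : 0 ≤ A2 := ringVarTheta_self_nonneg s T hwa
  have hWnn : 0 ≤ W := by linarith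
  have hflow' : W = -(μ * δt * ringVarTheta 𝒯 s (Θ + T) T) := by
    have := congrArg (fun r => δt * r) hflow
    simp only [← mul_assoc, mul_one_div_cancel hδt.ne', one_mul] at this
    rw [this]; ring
  -- The `T`, `T` part of the implicit form has the favourable sign and is dropped. Cauchy-Schwarz
  -- then bounds `W²`, and not merely `W`, by a multiple of `δt² A2`, which is what allows
  -- absorption.
  have hW2le : W ^ 2 ≤ (μ * δt) ^ 2 * (4 * |Emax| * A2) := by
    have h0 : 0 < μ * δt := mul_pos hμ hδt
    have h1 : W ≤ -(μ * δt * ringVarTheta 𝒯 s Θ T) := by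
      rw [hflow', ringVarTheta_add_left]
      nlinarith
    have h2 := sq_ringVarTheta_le s Θ T hwa
    have h3 : ringVarTheta 𝒯 s Θ Θ ≤ 4 * |Emax| := by
      linarith [ringVarTheta_le_mainEnergy hwa hd s Θ, le_abs_self Emax]
    calc W ^ 2 ≤ (-(μ * δt * ringVarTheta 𝒯 s Θ T)) ^ 2 := pow_le_pow_left₀ hWnn h1 2
      _ = (μ * δt) ^ 2 * ringVarTheta 𝒯 s Θ T ^ 2 := by ring
      _ ≤ (μ * δt) ^ 2 * (ringVarTheta 𝒯 s Θ Θ * A2) := by gcongr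
      _ ≤ _ := by gcongr
  set κ := volume.real (Metric.ball (0 : Space d) 1) / (γ * σ) ^ d with hκ
  have hκpos : 0 < κ := by
    have := volume_unitBall_pos d
    positivity
  set M0 : ℝ := 2 ^ (d + 3) + 2 with hM0
  set K2 : ℝ := ((d : ℝ) + 1) ^ 2 * (d * σ ^ 2 * M0) with hK2
  have hM0pos : 0 < M0 := by positivity
  have hK2nn : 0 ≤ K2 := by positivity
  have hhd : 0 < κ * 𝒯.meshSize ^ d := by positivity
  set M := M0 / (κ * 𝒯.meshSize ^ d) * W with hM
  have hMnn : 0 ≤ M := by positivity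
  have htM : ∀ i, ‖t i‖ ^ 2 ≤ M := by
    intro i
    rw [hM, div_mul_eq_mul_div, le_div_iff₀ hhd]
    have := hinv i
    nlinarith
  set B := ∑ i, ∑ j, 𝒯.stiff i j * ((s i ^ 2 + s j ^ 2) / 2) *
    (2 * (‖t i‖ ^ 2 + ‖t j‖ ^ 2) * ‖t i - t j‖ ^ 2) with hB
  -- One factor `W` comes from the maximum norm of `t`, the other from its weighted gradient.
  have hB1 : B ≤ 4 * M * (K2 * W) := by
    calc B ≤ ∑ i, ∑ j, 𝒯.stiff i j * ((s i ^ 2 + s j ^ 2) / 2) * (4 * M * ‖t i - t j‖ ^ 2) := by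
          refine hwa.sum_le (w := fun i j => (s i ^ 2 + s j ^ 2) / 2) (weight_nonneg 𝒯 s)
            (fun i j => ?_) (fun i => by simp)
          have := htM i
          have := htM j
          exact mul_le_mul_of_nonneg_right (by linarith) (sq_nonneg _)
      _ = 4 * M * ∑ i, ∑ j, 𝒯.stiff i j * ((s i ^ 2 + s j ^ 2) / 2) * ‖t i - t j‖ ^ 2 := by
          simp only [Finset.mul_sum]
          exact Finset.sum_congr rfl fun i _ => Finset.sum_congr rfl fun j _ => by ring
      _ ≤ 4 * M * (K2 * W) := by
          refine mul_le_mul_of_nonneg_left (hdir.trans ?_) (by linarith)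
          exact mul_le_mul_of_nonneg_left (by linarith) hK2nn
  have hB2 : 3 * B ≤ 1 / 2 * A2 := by
    -- `96 = 6 · 4 · 4`: the target share `1/6`, the `4` in `hB1`, and the `4` in `hW2le`. The
    -- summand `1` in `stepConst` only keeps the constant positive when `Emax = 0`, and is discarded
    -- here.
    have hc : 96 * M0 * K2 * μ ^ 2 * |Emax| / κ * δt ^ 2 ≤ 𝒯.meshSize ^ d := by
      have e : stepConst d σ γ μ Emax = 96 * M0 * K2 * μ ^ 2 * |Emax| / κ + 1 := rfl
      rw [e] at hstep
      nlinarith [sq_nonneg δt]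
    rw [div_mul_eq_mul_div, div_le_iff₀ hκpos] at hc
    have h1 : 4 * M * (K2 * W) = 4 * M0 * K2 * W ^ 2 / (κ * 𝒯.meshSize ^ d) := by
      rw [hM]; ring
    have h2 : 4 * M0 * K2 * W ^ 2 / (κ * 𝒯.meshSize ^ d) ≤ 1 / 6 * A2 := by
      rw [div_le_iff₀ hhd]
      calc 4 * M0 * K2 * W ^ 2 ≤ 4 * M0 * K2 * ((μ * δt) ^ 2 * (4 * |Emax| * A2)) := by gcongr
        _ = 1 / 6 * A2 * (96 * M0 * K2 * μ ^ 2 * |Emax| * δt ^ 2) := by ring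
        _ ≤ 1 / 6 * A2 * (𝒯.meshSize ^ d * κ) := by gcongr
        _ = _ := by ring
    linarith
  have hmain : ringVarTheta 𝒯 s (lineOf 𝒯 n') (lineOf 𝒯 n') ≤
      ringVarTheta 𝒯 s Θ Θ + 2 * ringVarTheta 𝒯 s (Θ + T) T - 1 / 2 * A2 + 3 * B := by
    have h := hwa.sum_le (w := fun i j => (s i ^ 2 + s j ^ 2) / 2)
      (x := fun i j => frob (lineOf 𝒯 n' i - lineOf 𝒯 n' j) (lineOf 𝒯 n' i - lineOf 𝒯 n' j))
      (y := fun i j => frob (Θ i - Θ j) (Θ i - Θ j) +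
        2 * frob ((Θ i + T i) - (Θ j + T j)) (T i - T j)
        - 1 / 2 * frob (T i - T j) (T i - T j)
        + 3 * (2 * (‖t i‖ ^ 2 + ‖t j‖ ^ 2) * ‖t i - t j‖ ^ 2)) (weight_nonneg 𝒯 s)
      (fun i j => ?_) (fun i => by simp [frob_zero_left])
    · refine h.trans (le_of_eq ?_)
      simp only [hA2, hB, ringVarTheta, Finset.mul_sum, ← Finset.sum_add_distrib,
        ← Finset.sum_sub_distrib, Pi.add_apply]
      exact Finset.sum_congr rfl fun i _ => Finset.sum_congr rfl fun j _ => by ring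
    · simp only [lineOf, hproj]
      exact frob_sub_projection_le (hn i) (hn j) (ht i) (ht j) rfl rfl rfl rfl
  have hfin : ringVarTheta 𝒯 s (Θ + T) T = -(1 / (μ * δt) * W) := by
    rw [hflow']; field_simp
  rw [mainEnergy_eq, mainEnergy_eq]
  have e : 1 / δt * (1 / (2 * μ) * W) = 1 / 2 * (1 / (μ * δt) * W) := by field_simp
  rw [e]
  linarith

/-- The implicit gradient step for `s` with convex splitting decreases the energy. -/
theorem energy_gradientStep_le {ψ : SplitPotential} {ηB δt : ℝ} (hd : 1 ≤ d) (hη : 0 < ηB)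
    (hwa : 𝒯.WeaklyAcute) {s s' : 𝒯.Node → ℝ} {Θ : 𝒯.Node → Matrix (Fin d) (Fin d) ℝ}
    (hs : ∀ i, s i ∈ ψ.dom) (hs' : ∀ i, s' i ∈ ψ.dom)
    (hflow : 1 / δt * l2Inner 𝒯.domain (𝒯.fe (s' - s)) (𝒯.fe (s' - s)) =
      -(((d : ℝ) - 1) / d * dirichletInner 𝒯.domain (𝒯.fe s') (𝒯.fe (s' - s)))
        - 1 / 2 * ringVarS 𝒯 s' Θ (s' - s)
        - 1 / ηB * ∫ x in 𝒯.domain,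
          (ψ.dψc (𝒯.fe s' x) - ψ.dψe (𝒯.fe s x)) * 𝒯.fe (s' - s) x) :
    energy 𝒯 ψ ηB s' Θ + 1 / δt * l2Inner 𝒯.domain (𝒯.fe (s' - s)) (𝒯.fe (s' - s)) ≤
      energy 𝒯 ψ ηB s Θ := by
  have hbulk := bulkEnergy_sub_le 𝒯 ψ hη hs hs'
  have hd1 : (1 : ℝ) ≤ d := by exact_mod_cast hd
  -- Pairwise `a² - b² ≤ 2a(a - b)`: the quadratic term is convex and its derivative is taken at the
  -- new value. `hring` applies the same inequality to the nodal weights.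
  have hgrad : ∑ i, ∑ j, 𝒯.stiff i j * (s' i - s' j) ^ 2 -
      ∑ i, ∑ j, 𝒯.stiff i j * (s i - s j) ^ 2 ≤
      4 * dirichletInner 𝒯.domain (𝒯.fe s') (𝒯.fe (s' - s)) := by
    have h := hwa.sum_le (w := fun _ _ => 1) (x := fun i j => (s' i - s' j) ^ 2 - (s i - s j) ^ 2)
      (y := fun i j => 2 * ((s' i - s' j) * ((s' - s) i - (s' - s) j))) (fun _ _ => zero_le_one)
      (fun i j => by
        simp only [Pi.sub_apply]
        nlinarith [sq_nonneg ((s' i - s' j) - (s i - s j))]) (fun i => by simp)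
    rw [𝒯.dirichletInner_fe_eq_stiff]
    calc _ = ∑ i, ∑ j, 𝒯.stiff i j * 1 * ((s' i - s' j) ^ 2 - (s i - s j) ^ 2) := by
          simp only [← Finset.sum_sub_distrib]
          exact Finset.sum_congr rfl fun i _ => Finset.sum_congr rfl fun j _ => by ring
      _ ≤ _ := h
      _ = _ := by
          simp only [Finset.mul_sum]
          exact Finset.sum_congr rfl fun i _ => Finset.sum_congr rfl fun j _ => by ring
  have hring : ringVarTheta 𝒯 s' Θ Θ - ringVarTheta 𝒯 s Θ Θ ≤ 2 * ringVarS 𝒯 s' Θ (s' - s) := by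
    have h := hwa.sum_le (w := fun _ _ => 1)
      (x := fun i j => ((s' i ^ 2 + s' j ^ 2) / 2 - (s i ^ 2 + s j ^ 2) / 2) *
        frob (Θ i - Θ j) (Θ i - Θ j))
      (y := fun i j => (s' i * (s' - s) i + s' j * (s' - s) j) * frob (Θ i - Θ j) (Θ i - Θ j))
      (fun _ _ => zero_le_one)
      (fun i j => mul_le_mul_of_nonneg_right (by
        simp only [Pi.sub_apply]
        nlinarith [sq_nonneg (s' i - s i), sq_nonneg (s' j - s j)]) (frob_self_nonneg _))
      (fun i => by simp [frob_zero_left])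
    calc _ = _ := by
          simp only [ringVarTheta, ← Finset.sum_sub_distrib]
          exact Finset.sum_congr rfl fun i _ => Finset.sum_congr rfl fun j _ => by ring
      _ ≤ _ := h
      _ = _ := by
          simp only [ringVarS, Finset.mul_sum]
          exact Finset.sum_congr rfl fun i _ => Finset.sum_congr rfl fun j _ => by ring
  have hgrad' := mul_le_mul_of_nonneg_left hgrad
    (div_nonneg (by linarith) (by linarith) : (0 : ℝ) ≤ ((d : ℝ) - 1) / (4 * d))
  have e : ((d : ℝ) - 1) / (4 * d) * (4 * dirichletInner 𝒯.domain (𝒯.fe s') (𝒯.fe (s' - s))) =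
      ((d : ℝ) - 1) / d * dirichletInner 𝒯.domain (𝒯.fe s') (𝒯.fe (s' - s)) := by
    field_simp
  rw [e, mul_sub] at hgrad'
  rw [hflow, energy, energy, mainEnergy_eq, mainEnergy_eq]
  linarith

/-- One step of the flow decreases the energy. -/
theorem IsFlowStep.energy_le {σ γ μ δt Emax ηB : ℝ} {ψ : SplitPotential} {Γs ΓΘ : Set (Space d)}
    {g : Space d → ℝ} {s s' : 𝒯.Node → ℝ} {n n' t : 𝒯.Node → Space d}
    (h : IsFlowStep 𝒯 ψ ηB μ δt Γs ΓΘ g s s' n n' t)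
    (hd : 1 ≤ d) (hσ : 0 < σ) (hγ : 0 < γ) (hμ : 0 < μ) (hδt : 0 < δt) (hη : 0 < ηB)
    (hsr : 𝒯.ShapeRegular σ) (hqu : 𝒯.QuasiUniform γ) (hwa : 𝒯.WeaklyAcute)
    (hh : 0 < 𝒯.meshSize) (hstep : stepConst d σ γ μ Emax * δt ^ 2 ≤ 𝒯.meshSize ^ d)
    (hn : ∀ i, ‖n i‖ = 1) (hs : ∀ i, s i ∈ ψ.dom)
    (hbd : ∀ x ∈ Γs, 𝒯.fe s x = 𝒯.fe (𝒯.nodal g) x)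
    (hE : energy 𝒯 ψ ηB s (lineOf 𝒯 n) ≤ Emax) :
    energy 𝒯 ψ ηB s' (lineOf 𝒯 n') + 1 / δt *
      (1 / (2 * μ) * weightedInner 𝒯.domain (fun x => 𝒯.fe s x ^ 2) (𝒯.fe t) (𝒯.fe t) +
        l2Inner 𝒯.domain (𝒯.fe (s' - s)) (𝒯.fe (s' - s))) ≤ energy 𝒯 ψ ηB s (lineOf 𝒯 n) := by
  -- Nonnegativity of the bulk part turns the bound on the total energy into one on the main part.
  have hb := bulkEnergy_nonneg 𝒯 ψ hη hs
  have h1 := mainEnergy_projection_le hd hσ hγ hμ hδt hsr hqu hwa hh hstep hn h.t_mem.1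
    (by rw [energy] at hE; linarith) (h.tangent_flow t h.t_mem) h.projection
  -- `s' - s` is an admissible test function because both carry the same data on `Γs`.
  have h2 := energy_gradientStep_le (Θ := lineOf 𝒯 n') hd hη hwa hs h.s_dom
    (h.s_flow (s' - s) fun x hx => by rw [𝒯.fe_sub, h.s_bdry x hx, hbd x hx, sub_self])
  have e1 : energy 𝒯 ψ ηB s (lineOf 𝒯 n') =
    mainEnergy 𝒯 s (lineOf 𝒯 n') + bulkEnergy 𝒯 ψ ηB s := rfl
  have e2 : energy 𝒯 ψ ηB s (lineOf 𝒯 n) =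
    mainEnergy 𝒯 s (lineOf 𝒯 n) + bulkEnergy 𝒯 ψ ηB s := rfl
  rw [mul_add]
  linarith

end UniaxialQ
end

/-! ### Iteration over the time steps. -/

theorem mainTheorem2 (d : ℕ) (hd : 2 ≤ d) (σ γ μ Emax : ℝ) (hσ : 0 < σ) (hγ : 0 < γ)
    (hμ : 0 < μ) :
    ∃ C : ℝ, 0 < C ∧
      ∀ (𝒯 : UniaxialQ.Mesh d), 𝒯.ShapeRegular σ → 𝒯.QuasiUniform γ → 𝒯.WeaklyAcute →
      ∀ (ψ : UniaxialQ.SplitPotential) (ηB δt : ℝ), 0 < ηB →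
        0 < δt → δt < C * 𝒯.meshSize ^ ((d : ℝ) / 2) →
      ∀ (Γs ΓΘ : Set (UniaxialQ.Space d)) (g : UniaxialQ.Space d → ℝ)
        (M : UniaxialQ.Space d → Matrix (Fin d) (Fin d) ℝ)
        (s : ℕ → 𝒯.Node → ℝ) (n t : ℕ → 𝒯.Node → UniaxialQ.Space d) (N : ℕ),
        (∀ i, ‖n 0 i‖ = 1) →
        UniaxialQ.Admissible 𝒯 Γs ΓΘ g M (s 0) (UniaxialQ.lineOf 𝒯 (n 0)) →
        (∀ i, s 0 i ∈ ψ.dom) →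
        UniaxialQ.energy 𝒯 ψ ηB (s 0) (UniaxialQ.lineOf 𝒯 (n 0)) ≤ Emax →
        (∀ k < N, UniaxialQ.IsFlowStep 𝒯 ψ ηB μ δt Γs ΓΘ g
          (s k) (s (k + 1)) (n k) (n (k + 1)) (t k)) →
        UniaxialQ.energy 𝒯 ψ ηB (s N) (UniaxialQ.lineOf 𝒯 (n N)) +
            1 / δt * ∑ k ∈ Finset.range N,
              (1 / (2 * μ) * UniaxialQ.weightedInner 𝒯.domain (fun x => 𝒯.fe (s k) x ^ 2)
                  (𝒯.fe (t k)) (𝒯.fe (t k)) +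
                UniaxialQ.l2Inner 𝒯.domain (𝒯.fe (s (k + 1) - s k)) (𝒯.fe (s (k + 1) - s k)))
          ≤ UniaxialQ.energy 𝒯 ψ ηB (s 0) (UniaxialQ.lineOf 𝒯 (n 0)) ∧
        ∀ k < N, UniaxialQ.energy 𝒯 ψ ηB (s (k + 1)) (UniaxialQ.lineOf 𝒯 (n (k + 1))) ≤
          UniaxialQ.energy 𝒯 ψ ηB (s k) (UniaxialQ.lineOf 𝒯 (n k)) := by
  have hD := UniaxialQ.stepConst_pos d hσ hγ μ Emax
  set D := UniaxialQ.stepConst d σ γ μ Emax with hDdef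
  refine ⟨1 / √D, by positivity, ?_⟩
  intro 𝒯 hsr hqu hwa ψ ηB δt hη hδt hlt Γs ΓΘ g M s n t N hn hadm hs hE hflow
  -- If the mesh size were zero, for instance on an empty mesh, the step restriction would
  -- contradict `0 < δt`, since `d / 2` is nonzero.
  have hh : 0 < 𝒯.meshSize := by
    refine 𝒯.meshSize_nonneg.lt_of_ne fun h0 => ?_
    have hd0 : (d : ℝ) / 2 ≠ 0 := by positivity
    rw [← h0, Real.zero_rpow hd0, mul_zero] at hlt
    exact hlt.not_gt hδt
  have hstep : D * δt ^ 2 ≤ 𝒯.meshSize ^ d := by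
    have h1 : (𝒯.meshSize ^ ((d : ℝ) / 2)) ^ 2 = 𝒯.meshSize ^ d := by
      rw [← Real.rpow_natCast, ← Real.rpow_mul hh.le, Nat.cast_ofNat,
        div_mul_cancel₀ _ two_ne_zero, Real.rpow_natCast]
    have h2 : δt ^ 2 ≤ (1 / √D * 𝒯.meshSize ^ ((d : ℝ) / 2)) ^ 2 :=
      pow_le_pow_left₀ hδt.le hlt.le 2
    rw [mul_pow, h1, div_pow, Real.sq_sqrt hD.le, one_pow, one_div, inv_mul_eq_div,
      le_div_iff₀ hD] at h2
    linarith
  have hnn : ∀ k, 0 ≤ 1 / δt * (1 / (2 * μ) * UniaxialQ.weightedInner 𝒯.domain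
      (fun x => 𝒯.fe (s k) x ^ 2) (𝒯.fe (t k)) (𝒯.fe (t k)) +
      UniaxialQ.l2Inner 𝒯.domain (𝒯.fe (s (k + 1) - s k)) (𝒯.fe (s (k + 1) - s k))) := by
    intro k
    obtain ⟨h1, h2⟩ := 𝒯.weightedInner_fe_self_bounds (s k) (t k)
    refine mul_nonneg (by positivity) (add_nonneg (mul_nonneg (by positivity) (add_nonneg h1 h2)) ?_)
    exact MeasureTheory.integral_nonneg fun _ => real_inner_self_nonneg
  have hinv : ∀ k ≤ N, (∀ i, ‖n k i‖ = 1) ∧ (∀ i, s k i ∈ ψ.dom) ∧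
      ∀ x ∈ Γs, 𝒯.fe (s k) x = 𝒯.fe (𝒯.nodal g) x := by
    intro k hk
    rcases k with _ | k
    · exact ⟨hn, hs, hadm.s_bdry⟩
    · have := hflow k hk
      exact ⟨this.unit', this.s_dom, this.s_bdry⟩
  have hone : ∀ k < N, UniaxialQ.energy 𝒯 ψ ηB (s k) (UniaxialQ.lineOf 𝒯 (n k)) ≤ Emax →
      _ := fun k hk hEk => (hflow k hk).energy_le (by omega) hσ hγ hμ hδt hη hsr hqu hwa hh hstep
        (hinv k hk.le).1 (hinv k hk.le).2.1 (hinv k hk.le).2.2 hEk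
  -- The bound by `Emax` is carried along in the induction, so the same step restriction applies at
  -- every time level.
  have hsum : ∀ m ≤ N, UniaxialQ.energy 𝒯 ψ ηB (s m) (UniaxialQ.lineOf 𝒯 (n m)) +
      1 / δt * ∑ k ∈ Finset.range m,
        (1 / (2 * μ) * UniaxialQ.weightedInner 𝒯.domain (fun x => 𝒯.fe (s k) x ^ 2)
            (𝒯.fe (t k)) (𝒯.fe (t k)) +
          UniaxialQ.l2Inner 𝒯.domain (𝒯.fe (s (k + 1) - s k)) (𝒯.fe (s (k + 1) - s k)))
      ≤ UniaxialQ.energy 𝒯 ψ ηB (s 0) (UniaxialQ.lineOf 𝒯 (n 0)) ∧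
      UniaxialQ.energy 𝒯 ψ ηB (s m) (UniaxialQ.lineOf 𝒯 (n m)) ≤ Emax := by
    intro m
    induction m with
    | zero => intro _; simpa using hE
    | succ m ih =>
      intro hm
      obtain ⟨ih1, ih2⟩ := ih (by omega)
      have h := hone m (by omega) ih2
      have := hnn m
      refine ⟨?_, by linarith⟩
      rw [Finset.sum_range_succ, mul_add]
      linarith
  refine ⟨(hsum N le_rfl).1, fun k hk => ?_⟩
  have h := hone k hk (hsum k hk.le).2
  have := hnn k
  linarith
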